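/- **Setting.** Let $\mathcal L$ be a first-order language with equality, $\mathit{Pred}_u\subseteq\mathcal L$ the user-defined predicate symbols (infinitely many of each arity), and $\mathbb D$ an interpretation, with non-empty universe $U$, of $\mathcal L\setminus \mathit{Pred}_u$. Let $\mathcal A\subseteq\mathcal C$ be sets of formulas of $\mathcal L\setminus \mathit{Pred}_u$, each containing $\mathit{true}$, $\mathit{false}$ and all equalities between terms, and closed under conjunction and under renaming of variables. An *atom* is $p(X_1,\dots,X_m)$ with $p\in \mathit{Pred}_u$ and $X_1,\dots,X_m$ distinct variables. A *clause* over $\mathcal C$ is $H\leftarrow c,G$ with $H$ an atom or $\mathit{false}$, $c\in\mathcal C$, and $G$ a finite conjunction of atoms; other arguments in atoms, such as repeated variables, abbreviate fresh variables with equalities in the constraint. A set of clauses is *$\mathbb D$-satisfiable* if it is true in some interpretation of $\mathcal L$ that agrees with $\mathbb D$ outside $\mathit{Pred}_u$. Let $\mathcal A^{\exists\vee}$ be the set of formulas $\exists X_1\dots\exists X_m(\varphi_1\vee\dots\vee\varphi_n)$, with $m\ge 0$, $n>0$, $\varphi_i\in\mathcal A$. An *$\mathcal A$-definable model* of a set $P$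 of clauses is a map $\Sigma$ from atoms to $\mathcal A^{\exists\vee}$, extended by $\Sigma(\mathit{false})=\mathit{false}$, such that the free variables of $\Sigma(A)$ are among those of $A$, $\Sigma(A\rho)=\Sigma(A)\rho$ for every renaming $\rho$, and $\mathbb D\models\forall(c\wedge\Sigma(A_1)\wedge\dots\wedge\Sigma(A_n)\to\Sigma(H))$ for every clause $H\leftarrow c,A_1,\dots,A_n$ of $P$. **Algorithm (Predicate Pairing).** *Input:* a clause $C_{\mathit{init}}$ of the form $\mathit{false}\leftarrow c,q(X),r(Y)$ over $\mathcal C$, and disjoint finite sets $Q,R$ of clauses over $\mathcal C$ with no predicate symbol in common, with $q$ occurring in $Q$ and $r$ in $R$. An atom is a $Q$-atom (an $R$-atom) if its predicate symbol occurs in $Q$ (in $R$). For a constraint $d$ and atoms $A,B$, let $\mathit{Eq}(d,A,B)$ be the set of equalities $X=Y$, with $X$ a variable of $A$ and $Y$ a variable of $B$, such that $\mathbb D\models\forall(d\to X=Y)$. Start with $\mathit{InCls}=\{C_{\mathit{init}}\}$, $\mathit{Defs}=\emptyset$, $\mathit{TransfCls}=Q\cup R$. While $\mathit{InCls}$ contains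 a clause $C$ of the form $L\leftarrow c,A_Q,B_R$ with $A_Q$ a $Q$-atom and $B_R$ an $R$-atom: 1. *Unfolding:* let $\mathit{FoldedCls}$ be obtained from $C$ by unfolding $A_Q$ once and $B_R$ once using $Q\cup R$. (Unfolding an atom $A$ in $H\leftarrow c,A,G$ yields the clauses $H\leftarrow c,c_j,B_j,G$, where $A\leftarrow c_j,B_j$ are the clauses of $Q\cup R$ with the predicate of $A$ in the head, suitably renamed so as to share with the unfolded clause only variables of $A$.) 2. *Definition and folding:* while $\mathit{FoldedCls}$ contains a clause $E$ of the form $H\leftarrow d,A,B,G$, with $A$ a $Q$-atom, $B$ an $R$-atom and $|\mathit{Eq}(d,A,B)|\ge|\mathit{Eq}(d,M,N)|$ for every $Q$-atom $M$ and $R$-atom $N$ in $A,B,G$: if for some clause $H'\leftarrow d',A',B'$ in $\mathit{Defs}$ and some substitution $\vartheta$ the pair $A,B$ can be folded in $E$ (that is, $A=A'\vartheta$, $B=B'\vartheta$, $\mathbb D\models\forall(d\leftrightarrow(e\wedge d'\vartheta))$ for some constraint $e$, and every variable $X$ of $d',A',B'$ not in $H'$ is mapped to a variable that does not occur in $H,d,G$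 and is not in the image of any other variable of $d',A',B'$), then replace $E$ in $\mathit{FoldedCls}$ by $H\leftarrow d,H'\vartheta,G$; otherwise replace $E$ by $H\leftarrow d,\mathit{newp}(Z),G$, and add the definition $\mathit{newp}(Z)\leftarrow e,A,B$ to both $\mathit{Defs}$ and $\mathit{InCls}$, where $\mathit{newp}$ is a fresh predicate symbol, $Z$ lists the variables of $A$ and $B$, and $e$ is the conjunction of the equalities in $\mathit{Eq}(d,A,B)$. 3. Remove $C$ from $\mathit{InCls}$ and add $\mathit{FoldedCls}$ to $\mathit{TransfCls}$. *Output:* $\mathit{TransfCls}$. **Theorem 5.** On every such input, and whatever choices are made, the Predicate Pairing algorithm terminates (it never runs forever and never gets stuck), and the number of definitions it introduces is bounded by a number depending only on the input. Moreover, every set $\mathit{TransfCls}$ that it returns satisfies: (i) $\{C_{\mathit{init}}\}\cup Q\cup R$ is $\mathbb D$-satisfiable if and only if $\mathit{TransfCls}$ is $\mathbb D$-satisfiable; (ii) if $\{C_{\mathit{init}}\}\cup Q\cup R$ has an $\mathcal A$-definable model, then $\mathit{TransfCls}$ has an $\mathcal A$-definable model. -/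

import Mathlib

universe u v w x

namespace CHC

noncomputable section

/-! ### Constraints

The language `L` plays the role of the first order language without the user-defined predicate
symbols. Its formulas have free variables named by natural numbers; bound variables are nameless. -/

section Constraints

variable {L : FirstOrder.Language.{u, v}}

/-- The finite set of the free variables of a formula. -/
def fvars (φ : L.Formula ℕ) : Finset ℕ := FirstOrder.Language.BoundedFormula.freeVarFinset φ

/-- The equality `X = Y` between two variables. -/
def varEq (X Y : ℕ) : L.Formula ℕ := (FirstOrder.Language.Term.var X).equal (FirstOrder.Language.Term.var Y)

/-- The formula `∃ X φ`, where the variable named `X` becomes bound. -/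
def exVar (X : ℕ) (φ : L.Formula ℕ) : L.Formula ℕ :=
  FirstOrder.Language.BoundedFormula.ex (n := 0)
    (FirstOrder.Language.BoundedFormula.relabel (n := 1) (k := 0)
      (fun Y => if Y = X then Sum.inr 0 else Sum.inl Y) φ)

/-- A class of constraints: it contains `true`, `false` and the equalities between terms, and it is
closed under conjunction and under the renaming of variables. -/
structure IsConstraintClass (S : Set (L.Formula ℕ)) : Prop where
  top_mem : (⊤ : L.Formula ℕ) ∈ S
  bot_mem : (⊥ : L.Formula ℕ) ∈ S
  equal_mem : ∀ s t : L.Term ℕ, s.equal t ∈ S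
  inf_mem : ∀ φ ∈ S, ∀ ψ ∈ S, φ ⊓ ψ ∈ S
  rename_mem : ∀ σ : Equiv.Perm ℕ, ∀ φ ∈ S, φ.relabel σ ∈ S

/-- The disjunctions `φ₁ ∨ … ∨ φₙ`, `n > 0`, of formulas of `S`. -/
inductive IsDisj (S : Set (L.Formula ℕ)) : L.Formula ℕ → Prop
  | single (φ : L.Formula ℕ) : φ ∈ S → IsDisj S φ
  | sup (φ ψ : L.Formula ℕ) : IsDisj S φ → IsDisj S ψ → IsDisj S (φ ⊔ ψ)

/-- The formulas `∃ X₁ … ∃ Xₘ (φ₁ ∨ … ∨ φₙ)`, `m ≥ 0`, `n > 0`, with every `φᵢ` in `S`. -/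
inductive IsExDisj (S : Set (L.Formula ℕ)) : L.Formula ℕ → Prop
  | disj (φ : L.Formula ℕ) : IsDisj S φ → IsExDisj S φ
  | ex (X : ℕ) (φ : L.Formula ℕ) : IsExDisj S φ → IsExDisj S (exVar X φ)

end Constraints

/-! ### Atoms and constrained Horn clauses -/

section Clauses

variable (L : FirstOrder.Language.{u, v}) {Pred : Type x} (ar : Pred → ℕ)

/-- An atom `p(X₁, …, Xₘ)`, where `X₁, …, Xₘ` are distinct variables. -/
@[ext]
structure Atom where
  pred : Pred
  args : Fin (ar pred) → ℕ
  distinct : Function.Injective args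

/-- A constrained Horn clause `head ← constr, body`. The head `none` stands for `false`, that is,
the clause is then a goal; the body is a conjunction of atoms. -/
@[ext]
structure Clause where
  head : Option (Atom ar)
  constr : L.Formula ℕ
  body : Multiset (Atom ar)

variable {L} {ar}

namespace Atom

/-- The set of the variables of an atom. -/
def vars (a : Atom ar) : Finset ℕ := Finset.univ.image a.args

/-- The image of an atom under a renaming of the variables. -/
def rename (σ : Equiv.Perm ℕ) (a : Atom ar) : Atom ar :=
  ⟨a.pred, fun i => σ (a.args i), σ.injective.comp a.distinct⟩

/-- `A'.Inst θ A` means that `A = A' θ`, for a substitution `θ` of variables for variables. -/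
def Inst (A' : Atom ar) (θ : ℕ → ℕ) (A : Atom ar) : Prop :=
  (⟨A'.pred, fun i => θ (A'.args i)⟩ : Σ p : Pred, (Fin (ar p) → ℕ)) = ⟨A.pred, A.args⟩

end Atom

namespace Clause

/-- The free variables of the body of a clause, including those of its constraint. -/
def bodyVars (C : Clause L ar) : Set ℕ := {X | X ∈ fvars C.constr ∨ ∃ a ∈ C.body, X ∈ a.vars}

/-- The variables of the head of a clause. -/
def headVars (C : Clause L ar) : Set ℕ := {X | ∃ a ∈ C.head, X ∈ a.vars}

/-- The variables of a clause. -/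
def vars (C : Clause L ar) : Set ℕ := C.headVars ∪ C.bodyVars

/-- The predicate symbols occurring in a clause. -/
def preds (C : Clause L ar) : Set Pred := {p | (∃ a ∈ C.head, a.pred = p) ∨ ∃ a ∈ C.body, a.pred = p}

/-- The variant of a clause obtained by a renaming of the variables. -/
def rename (σ : Equiv.Perm ℕ) (C : Clause L ar) : Clause L ar :=
  ⟨C.head.map (Atom.rename σ), C.constr.relabel σ, C.body.map (Atom.rename σ)⟩

end Clause

/-- The predicate symbols occurring in a set of clauses. -/
def predsOf (P : Set (Clause L ar)) : Set Pred := {p | ∃ C ∈ P, p ∈ C.preds}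

/-- The clauses of `P` are over the set `S` of constraints. -/
def Over (S : Set (L.Formula ℕ)) (P : Set (Clause L ar)) : Prop := ∀ C ∈ P, C.constr ∈ S

end Clauses

/-! ### Models

The universe `U` with its `L`-structure is the canonical interpretation `𝔻`. -/

section Models

variable {L : FirstOrder.Language.{u, v}} {Pred : Type x} {ar : Pred → ℕ}

/-- A `𝔻`-interpretation: a relation over the universe for each user-defined predicate symbol. -/
def Interp (ar : Pred → ℕ) (U : Type w) := (p : Pred) → (Fin (ar p) → U) → Prop

/-- An atom holds in a `𝔻`-interpretation under a valuation of the variables. -/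
def Interp.Holds {U : Type w} (I : Interp ar U) (val : ℕ → U) (a : Atom ar) : Prop :=
  I a.pred (fun i => val (a.args i))

/-- The head of a clause holds, where `false` does not hold. -/
def Interp.HoldsHead {U : Type w} (I : Interp ar U) (val : ℕ → U) : Option (Atom ar) → Prop
  | none => False
  | some a => I.Holds val a

/-- `I` is a `𝔻`-model of the set `P` of clauses. -/
def Interp.IsModel {U : Type w} [L.Structure U] (I : Interp ar U) (P : Set (Clause L ar)) : Prop :=
  ∀ C ∈ P, ∀ val : ℕ → U,
    C.constr.Realize val → (∀ a ∈ C.body, I.Holds val a) → I.HoldsHead val C.head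

/-- `P` is `𝔻`-satisfiable. -/
def DSat (U : Type w) [L.Structure U] (P : Set (Clause L ar)) : Prop :=
  ∃ I : Interp ar U, I.IsModel P

/-- A symbolic interpretation, over the class `A` of constraints. A renaming substitution for an
atom is injective on its variables, and hence it acts on them as a permutation of all variables. -/
structure SymbInterp (ar : Pred → ℕ) (A : Set (L.Formula ℕ)) where
  toFun : Atom ar → L.Formula ℕ
  mem : ∀ a, IsExDisj A (toFun a)
  fvars_subset : ∀ a, fvars (toFun a) ⊆ a.vars
  rename : ∀ (σ : Equiv.Perm ℕ) (a : Atom ar), toFun (a.rename σ) = (toFun a).relabel σ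

/-- The value of a symbolic interpretation on a clause head; the value of `false` is `false`. -/
def SymbInterp.onHead {A : Set (L.Formula ℕ)} (S : SymbInterp ar A) :
    Option (Atom ar) → L.Formula ℕ
  | none => ⊥
  | some a => S.toFun a

/-- The symbolic interpretation `S` is an `A`-definable model of `P`. -/
def SymbInterp.IsModel {A : Set (L.Formula ℕ)} (S : SymbInterp ar A) (U : Type w) [L.Structure U]
    (P : Set (Clause L ar)) : Prop :=
  ∀ C ∈ P, ∀ val : ℕ → U,
    C.constr.Realize val → (∀ a ∈ C.body, (S.toFun a).Realize val) → (S.onHead C.head).Realize val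

/-- `P` has an `A`-definable model. -/
def HasDefModel (A : Set (L.Formula ℕ)) (U : Type w) [L.Structure U] (P : Set (Clause L ar)) :
    Prop :=
  ∃ S : SymbInterp ar A, S.IsModel U P

end Models

/-! ### The transformations applied by the Predicate Pairing strategy -/

section Rules

variable {L : FirstOrder.Language.{u, v}} {Pred : Type x} {ar : Pred → ℕ}

/-- `T` is obtained from the clause `C` by unfolding the atom `A` of its body using `P`. For each
clause of `P` whose head predicate is that of `A`, one takes a variant with head `A` that shares
with `C` no variables but those of `A`. -/
def IsUnfolding (P : Set (Clause L ar)) (C : Clause L ar) (A : Atom ar) (T : Set (Clause L ar)) :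
    Prop :=
  ∃ G : Multiset (Atom ar), C.body = A ::ₘ G ∧
    ∃ σ : Clause L ar → Equiv.Perm ℕ,
      (∀ K ∈ P, ∀ a ∈ K.head, a.pred = A.pred →
        (K.rename (σ K)).head = some A ∧ (K.rename (σ K)).bodyVars ∩ C.vars ⊆ A.vars) ∧
      T = {E | ∃ K ∈ P, (∃ a ∈ K.head, a.pred = A.pred) ∧
        E = ⟨C.head, C.constr ⊓ (K.rename (σ K)).constr, G + (K.rename (σ K)).body⟩}

/-- `T` is obtained from the clause `C` by unfolding once the atom `A` and once the atom `B` of its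
body using `P`. -/
def IsDoubleUnfolding (P : Set (Clause L ar)) (C : Clause L ar) (A B : Atom ar)
    (T : Set (Clause L ar)) : Prop :=
  ∃ T₁ : Set (Clause L ar), IsUnfolding P C A T₁ ∧
    ∃ f : Clause L ar → Set (Clause L ar),
      (∀ E ∈ T₁, IsUnfolding P E B (f E)) ∧ T = ⋃ E ∈ T₁, f E

/-- The atoms `A, B` of the clause `H ← d, A, B, G` can be folded using the definition `D`, of the
form `K ← d', A', B'`, with the substitution `θ`. Renaming `D` apart from the clause beforehand
amounts to composing `θ` with the renaming. -/
def CanFold (𝒞 : Set (L.Formula ℕ)) (U : Type w) [L.Structure U] (H : Option (Atom ar))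
    (d : L.Formula ℕ) (A B : Atom ar) (G : Multiset (Atom ar)) (D : Clause L ar) (θ : ℕ → ℕ) :
    Prop :=
  (∃ A' B' : Atom ar, D.body = {A', B'} ∧ A'.Inst θ A ∧ B'.Inst θ B) ∧
  (∃ e ∈ 𝒞, ∀ val : ℕ → U,
    d.Realize val ↔ (e.Realize val ∧ (D.constr.relabel θ : L.Formula ℕ).Realize val)) ∧
  (∀ X ∈ D.bodyVars \ D.headVars,
    θ X ∉ (⟨H, d, G⟩ : Clause L ar).vars ∧ ∀ Y ∈ D.bodyVars, Y ≠ X → θ X ≠ θ Y)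

/-- `E'` is the clause `H ← d, K θ, G`, written with distinct variables in the atom that replaces
`K θ`: a repeated occurrence of a variable in `K θ` is replaced by a variable not occurring
elsewhere, and the corresponding equality is added to the constraint. The variables of the original
clause are those in `V`. -/
def IsReplaced (V : Set ℕ) (H : Option (Atom ar)) (d : L.Formula ℕ) (G : Multiset (Atom ar))
    (K : Atom ar) (θ : ℕ → ℕ) (E' : Clause L ar) : Prop :=
  ∃ N : Fin (ar K.pred) → ℕ, ∃ hN : Function.Injective N,
    (∀ i, (∀ j < i, θ (K.args j) ≠ θ (K.args i)) → N i = θ (K.args i)) ∧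
    (∀ i, (∃ j < i, θ (K.args j) = θ (K.args i)) → N i ∉ V) ∧
    E' = ⟨H,
      (List.finRange (ar K.pred)).foldl
        (fun φ i => if N i = θ (K.args i) then φ else φ ⊓ varEq (N i) (θ (K.args i))) d,
      ⟨K.pred, N, hN⟩ ::ₘ G⟩

open Classical in
/-- The equalities between a variable of `A` and a variable of `B` that are implied by `d`; the
equality `X = Y` is represented by the pair `(X, Y)`. -/
def eqPairs (U : Type w) [L.Structure U] (d : L.Formula ℕ) (A B : Atom ar) : Finset (ℕ × ℕ) :=
  (A.vars ×ˢ B.vars).filter (fun z => ∀ val : ℕ → U, d.Realize val → val z.1 = val z.2)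

/-- The conjunction of a list of equalities. -/
def conjEqs (l : List (ℕ × ℕ)) : L.Formula ℕ := l.foldr (fun z φ => varEq z.1 z.2 ⊓ φ) ⊤

end Rules

/-! ### The Predicate Pairing strategy as a transition system -/

section Strategy

variable {L : FirstOrder.Language.{u, v}} {Pred : Type x} {ar : Pred → ℕ}

/-- A state of the strategy. `current` is `none` at the test of the outer loop, and it is
`some (C, FoldedCls)` at the test of the inner loop, while the clause `C` is being processed. -/
structure State (L : FirstOrder.Language.{u, v}) (ar : Pred → ℕ) where
  current : Option (Clause L ar × Set (Clause L ar))
  inCls : Set (Clause L ar)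
  defs : Set (Clause L ar)
  transfCls : Set (Clause L ar)

/-- The state after the initial assignments. -/
def initState (Cinit : Clause L ar) (Q R : Set (Clause L ar)) : State L ar :=
  ⟨none, {Cinit}, ∅, Q ∪ R⟩

/-- The predicate symbols occurring in a state. -/
def State.preds (s : State L ar) : Set Pred :=
  predsOf s.inCls ∪ predsOf s.defs ∪ predsOf s.transfCls ∪
    {p | ∃ c ∈ s.current, p ∈ c.1.preds ∪ predsOf c.2}

/-- The condition of the outer loop: the clause `C` in `InCls` is of the form `L ← c, A, B`, where
`A` occurs in `Q` and `B` occurs in `R`. -/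
def OuterCond (Q R : Set (Clause L ar)) (inCls : Set (Clause L ar)) (C : Clause L ar)
    (A B : Atom ar) : Prop :=
  C ∈ inCls ∧ C.body = {A, B} ∧ A.pred ∈ predsOf Q ∧ B.pred ∈ predsOf R

/-- The condition of the inner loop: the clause `H ← d, A, B, G` is in `FoldedCls`, the predicates
of `A` and `B` occur in `Q` and `R`, respectively, and no pair of such atoms of the clause has more
implied equalities than `A, B`. -/
def InnerCond (U : Type w) [L.Structure U] (Q R : Set (Clause L ar)) (folded : Set (Clause L ar))
    (H : Option (Atom ar)) (d : L.Formula ℕ) (A B : Atom ar) (G : Multiset (Atom ar)) : Prop :=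
  (⟨H, d, A ::ₘ B ::ₘ G⟩ : Clause L ar) ∈ folded ∧ A.pred ∈ predsOf Q ∧ B.pred ∈ predsOf R ∧
  ∀ M ∈ A ::ₘ B ::ₘ G, ∀ N ∈ A ::ₘ B ::ₘ G, M.pred ∈ predsOf Q → N.pred ∈ predsOf R →
    (eqPairs U d M N).card ≤ (eqPairs U d A B).card

/-- One step of the (nondeterministic) Predicate Pairing strategy. -/
inductive Step (𝒞 : Set (L.Formula ℕ)) (U : Type w) [L.Structure U] (Q R : Set (Clause L ar)) :
    State L ar → State L ar → Prop
  /-- Entering the body of the outer loop: unfolding, and initialization of `FoldedCls`. -/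
  | unfold (inCls defs transf : Set (Clause L ar)) (C : Clause L ar) (A B : Atom ar)
      (T : Set (Clause L ar)) (hC : OuterCond Q R inCls C A B)
      (hT : IsDoubleUnfolding (Q ∪ R) C A B T) :
      Step 𝒞 U Q R ⟨none, inCls, defs, transf⟩ ⟨some (C, T), inCls, defs, transf⟩
  /-- The body of the inner loop, when folding using an available definition is possible. -/
  | fold (inCls defs transf : Set (Clause L ar)) (C : Clause L ar) (T : Set (Clause L ar))
      (H : Option (Atom ar)) (d : L.Formula ℕ) (A B : Atom ar) (G : Multiset (Atom ar))
      (D : Clause L ar) (K : Atom ar) (θ : ℕ → ℕ) (E' : Clause L ar)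
      (hE : InnerCond U Q R T H d A B G) (hD : D ∈ defs) (hK : D.head = some K)
      (hf : CanFold 𝒞 U H d A B G D θ)
      (hE' : IsReplaced (⟨H, d, A ::ₘ B ::ₘ G⟩ : Clause L ar).vars H d G K θ E') :
      Step 𝒞 U Q R ⟨some (C, T), inCls, defs, transf⟩
        ⟨some (C, (T \ {⟨H, d, A ::ₘ B ::ₘ G⟩}) ∪ {E'}), inCls, defs, transf⟩
  /-- The body of the inner loop, when no available definition can be used for folding: the new
  definition `N ← e, A, B` is introduced. -/
  | define (inCls defs transf : Set (Clause L ar)) (C : Clause L ar) (T : Set (Clause L ar))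
      (H : Option (Atom ar)) (d : L.Formula ℕ) (A B : Atom ar) (G : Multiset (Atom ar))
      (N : Atom ar) (l : List (ℕ × ℕ))
      (hE : InnerCond U Q R T H d A B G)
      (hn : ¬ ∃ D ∈ defs, ∃ θ : ℕ → ℕ, CanFold 𝒞 U H d A B G D θ)
      (hnew : N.pred ∉ (⟨some (C, T), inCls, defs, transf⟩ : State L ar).preds ∪
        predsOf Q ∪ predsOf R)
      (hvars : N.vars = A.vars ∪ B.vars)
      (hl : l.Nodup ∧ l.toFinset = eqPairs U d A B) :
      Step 𝒞 U Q R ⟨some (C, T), inCls, defs, transf⟩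
        ⟨some (C, (T \ {⟨H, d, A ::ₘ B ::ₘ G⟩}) ∪ {⟨H, d, N ::ₘ G⟩}),
          inCls ∪ {⟨some N, conjEqs l, {A, B}⟩}, defs ∪ {⟨some N, conjEqs l, {A, B}⟩}, transf⟩
  /-- Exit from the inner loop, and the end of the body of the outer loop. -/
  | finish (inCls defs transf : Set (Clause L ar)) (C : Clause L ar) (T : Set (Clause L ar))
      (hn : ¬ ∃ H d A B G, InnerCond U Q R T H d A B G) :
      Step 𝒞 U Q R ⟨some (C, T), inCls, defs, transf⟩ ⟨none, inCls \ {C}, defs, transf ∪ T⟩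

/-- The states in which the strategy stops: the condition of the outer loop is false. -/
def State.IsFinal (Q R : Set (Clause L ar)) (s : State L ar) : Prop :=
  s.current = none ∧ ¬ ∃ C A B, OuterCond Q R s.inCls C A B

/-- The states that the strategy can reach on the given input. -/
def Reachable (𝒞 : Set (L.Formula ℕ)) (U : Type w) [L.Structure U] (Cinit : Clause L ar)
    (Q R : Set (Clause L ar)) (s : State L ar) : Prop :=
  Relation.ReflTransGen (Step 𝒞 U Q R) (initState Cinit Q R) s

end Strategy

end

end CHC

open CHC

/-!
Every definition `N ← e, A, B` made by the strategy lists in `N` all the variables of `A` and `B`,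
so that `N` can be read as a name for the constrained pair `e ∧ A ∧ B`, with no quantifier.

*Termination.* Call the shape of `A, B` under a constraint `d` the two predicate symbols together
with the pairs of argument positions that carry the same variable, and those that `d` makes equal.
The constraint `e` of a definition implies exactly the equalities that the constraint of the clause
implied when the definition was made, so a definition folds every later pair of its shape
(`canFold_of_shape_eq`). Hence definitions have distinct shapes, and there are finitely many shapes
(`finite_shapes`, `Inv.encard_defs_le`). Since each definition is processed once and each round of
the inner loop removes an atom from a finite set of clauses, a lexicographic measure decreases at
each step (`measure_lt_of_step`).

*From the original clauses to the transformed ones.* Extend a model of the original clauses by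
letting each new predicate mean its definition. Unfolding is resolution, and folding replaces
equals by equals, so all clauses ever produced are true (`Inv.isModel_transfCls`). For
`𝒜`-definable models the new predicate must denote a formula of `𝒜^{∃∨}`: the formula
`e ∧ Σ(A) ∧ Σ(B)` is brought into this form by prenexing and distributing (`IsExDisj.exists_inf`),
and its renamings give the values on the other atoms (`exists_equivariant`).

*From the transformed clauses to the original ones.* Let `J` be a model of the output, and
approximate the least model of `Q ∪ R` from below by the stages `I₀ ⊆ I₁ ⊆ …` of its immediate
consequence operator; each is contained in `J`. The processed clauses simulate each clause they
come from with a delay of one stage: if the body of the clause holds at stage `n + 1`, then after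
unfolding *both* atoms it holds at stage `n`, where the definitions used for folding are true by
induction, so that the clauses of the output apply (`Simulates`, `Inv.yields_stage`). Hence the body
of the initial clause holds at no stage, and the union of the stages is a model of the original
clauses (`Inv.dSat_of_transfCls`).

Simulation, soundness and the bookkeeping facts form the invariant `Inv` of the reachable states.
-/

namespace CHC

open FirstOrder Language

/-! ### Renaming the variables of a formula -/

section Renaming

variable {L : FirstOrder.Language.{u, v}} {α β γ : Type*}

/-- The extension of a map of free and bound variables under one more quantifier: the new bound
variable is mapped to the new bound variable. -/
def liftVar {n m : ℕ} (f : α ⊕ Fin n → β ⊕ Fin m) : α ⊕ Fin (n + 1) → β ⊕ Fin (m + 1) :=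
  Sum.elim (fun a => (f (Sum.inl a)).map id Fin.castSucc)
    (fun i => Fin.lastCases (motive := fun _ => β ⊕ Fin (m + 1)) (Sum.inr (Fin.last m))
      (fun j => (f (Sum.inr j)).map id Fin.castSucc) i)

/-- Simultaneous renaming of the free and the bound variables of a formula. It subsumes
`BoundedFormula.relabel`, and the numbers of bound variables of the two formulas are unrelated,
which makes the composition law `ren_ren` free of casts. -/
def ren : ∀ {n m : ℕ}, (α ⊕ Fin n → β ⊕ Fin m) → L.BoundedFormula α n → L.BoundedFormula β m
  | _, _, _, .falsum => .falsum
  | _, _, f, .equal s t => .equal (s.relabel f) (t.relabel f)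
  | _, _, f, .rel R ts => .rel R fun i => (ts i).relabel f
  | _, _, f, .imp φ ψ => .imp (ren f φ) (ren f ψ)
  | _, _, f, .all φ => .all (ren (liftVar f) φ)

theorem liftVar_comp {n m k : ℕ} (g : β ⊕ Fin m → γ ⊕ Fin k) (f : α ⊕ Fin n → β ⊕ Fin m) :
    liftVar g ∘ liftVar f = liftVar (g ∘ f) := by
  funext x
  rcases x with a | i
  · simp only [liftVar, Function.comp_apply, Sum.elim_inl]
    rcases f (Sum.inl a) with b | j <;> simp
  · refine Fin.lastCases ?_ (fun j => ?_) i
    · simp [liftVar]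
    · simp only [liftVar, Function.comp_apply, Sum.elim_inr, Fin.lastCases_castSucc]
      rcases f (Sum.inr j) with b | j <;> simp

theorem ren_ren {n : ℕ} (φ : L.BoundedFormula α n) : ∀ {m k : ℕ} (g : β ⊕ Fin m → γ ⊕ Fin k)
    (f : α ⊕ Fin n → β ⊕ Fin m), ren g (ren f φ) = ren (g ∘ f) φ := by
  induction φ with
  | falsum => intros; rfl
  | equal s t => intros; simp [ren]
  | rel R ts => intros; simp [ren]
  | imp φ ψ ih1 ih2 => intros; simp [ren, ih1, ih2]
  | all φ ih => intros; simp [ren, ih, liftVar_comp]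

theorem relabelAux_succ {n : ℕ} (g : α → β ⊕ Fin n) (k : ℕ) :
    BoundedFormula.relabelAux g (k + 1) = liftVar (BoundedFormula.relabelAux g k) := by
  funext x
  rcases x with a | i
  · simp only [liftVar, BoundedFormula.relabelAux, Function.comp_apply, Sum.elim_inl, Sum.map_inl]
    rcases g a with b | j
    · simp
    · simp
      rfl
  · refine Fin.lastCases ?_ (fun j => ?_) i
    · simp [liftVar, BoundedFormula.relabelAux]
    · simp [liftVar, BoundedFormula.relabelAux]

theorem relabel_eq_ren {n k : ℕ} (g : α → β ⊕ Fin n) (φ : L.BoundedFormula α k) :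
    φ.relabel g = ren (BoundedFormula.relabelAux g k) φ := by
  induction φ with
  | falsum => rfl
  | equal s t => rfl
  | rel R ts => rfl
  | imp φ ψ ih1 ih2 => simp [ren, ih1, ih2]
  | all φ ih => rw [BoundedFormula.relabel_all, ih, relabelAux_succ]; rfl

theorem Formula.relabel_eq_ren (g : α → β) (φ : L.Formula α) :
    φ.relabel g = ren (n := 0) (m := 0) (Sum.map g id) φ := by
  unfold Formula.relabel
  refine (CHC.relabel_eq_ren _ _).trans ?_
  congr 1
  funext x
  rcases x with a | i
  · simp [BoundedFormula.relabelAux]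
  · exact i.elim0

theorem Formula.relabel_relabel (f : α → β) (g : β → γ) (φ : L.Formula α) :
    (φ.relabel f).relabel g = φ.relabel (g ∘ f) := by
  rw [Formula.relabel_eq_ren, Formula.relabel_eq_ren, Formula.relabel_eq_ren, ren_ren]
  congr 1
  funext x
  rcases x with a | i <;> rfl

theorem Term.relabel_congr [DecidableEq α] {n : ℕ} {δ : Type*} (f g : α ⊕ Fin n → δ)
    (hr : ∀ i, f (Sum.inr i) = g (Sum.inr i)) (t : L.Term (α ⊕ Fin n))
    (hl : ∀ a ∈ t.varFinsetLeft, f (Sum.inl a) = g (Sum.inl a)) : t.relabel f = t.relabel g := by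
  induction t with
  | var x =>
    rcases x with a | i
    · simp [hl a (by simp)]
    · simp [hr i]
  | func F ts ih =>
    simp only [Term.relabel, Term.func.injEq, heq_eq_eq, true_and]
    funext i
    exact ih i fun a ha => hl a (by simpa using ⟨i, ha⟩)

theorem ren_congr [DecidableEq α] {n : ℕ} (φ : L.BoundedFormula α n) : ∀ {m : ℕ}
    (f g : α ⊕ Fin n → β ⊕ Fin m), (∀ i, f (Sum.inr i) = g (Sum.inr i)) →
    (∀ a ∈ φ.freeVarFinset, f (Sum.inl a) = g (Sum.inl a)) → ren f φ = ren g φ := by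
  induction φ with
  | falsum => intros; rfl
  | equal s t =>
    intro m f g hr hl
    simp only [ren]
    rw [Term.relabel_congr f g hr s fun a ha => hl a (by simp [ha]),
      Term.relabel_congr f g hr t fun a ha => hl a (by simp [ha])]
  | rel R ts =>
    intro m f g hr hl
    simp only [ren, BoundedFormula.rel.injEq, heq_eq_eq, true_and]
    funext i
    exact Term.relabel_congr f g hr (ts i) fun a ha => hl a (by simpa using ⟨i, ha⟩)
  | imp φ ψ ih1 ih2 =>
    intro m f g hr hl
    simp only [ren]
    rw [ih1 f g hr fun a ha => hl a (by simp [ha]), ih2 f g hr fun a ha => hl a (by simp [ha])]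
  | all φ ih =>
    intro m f g hr hl
    simp only [ren]
    rw [ih (liftVar f) (liftVar g)]
    · intro i
      refine Fin.lastCases ?_ (fun j => ?_) i
      · simp [liftVar]
      · simp [liftVar, hr]
    · intro a ha
      simp [liftVar, hl a ha]

/-- Renaming a formula depends only on the images of its free variables. -/
theorem relabel_congr (φ : L.Formula ℕ) {f g : ℕ → β} (h : ∀ X ∈ fvars φ, f X = g X) :
    φ.relabel f = φ.relabel g := by
  rw [Formula.relabel_eq_ren, Formula.relabel_eq_ren]
  exact ren_congr _ _ _ (fun i => i.elim0) fun a ha => by simp [h a ha]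

/-- The truth value of a formula depends only on the values of its free variables. A valuation can
itself be used as a renaming of the variables by elements of the universe, so that this is an
instance of `relabel_congr`. -/
theorem realize_congr {U : Type w} [L.Structure U] (φ : L.Formula ℕ) {val val' : ℕ → U}
    (h : ∀ X ∈ fvars φ, val X = val' X) : φ.Realize val ↔ φ.Realize val' := by
  have h1 : ∀ v : ℕ → U, (φ.relabel v).Realize id ↔ φ.Realize v := fun v => by
    rw [Formula.realize_relabel]; rfl
  rw [← h1 val, ← h1 val', relabel_congr φ h]

theorem Term.varFinsetLeft_relabel_subset [DecidableEq α] [DecidableEq β] {n m : ℕ}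
    (f : α ⊕ Fin n → β ⊕ Fin m) (hr : ∀ i, (f (Sum.inr i)).isRight) (t : L.Term (α ⊕ Fin n))
    (b : β) (hb : b ∈ (t.relabel f).varFinsetLeft) :
    ∃ a ∈ t.varFinsetLeft, f (Sum.inl a) = Sum.inl b := by
  induction t with
  | var x =>
    rcases x with a | i
    · refine ⟨a, by simp, ?_⟩
      simp only [Term.relabel] at hb
      rcases hfa : f (Sum.inl a) with b' | j
      · simp [hfa] at hb; simp [hb]
      · simp [hfa] at hb
    · simp only [Term.relabel] at hb
      rcases hfa : f (Sum.inr i) with b' | j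
      · have := hr i; simp [hfa] at this
      · simp [hfa] at hb
  | func F ts ih =>
    simp only [Term.relabel, Term.varFinsetLeft, Finset.mem_biUnion, Finset.mem_univ,
      true_and] at hb
    obtain ⟨i, hi⟩ := hb
    obtain ⟨a, ha, h⟩ := ih i hi
    exact ⟨a, by simpa using ⟨i, ha⟩, h⟩

theorem freeVarFinset_ren [DecidableEq α] [DecidableEq β] {n : ℕ} (φ : L.BoundedFormula α n) :
    ∀ {m : ℕ} (f : α ⊕ Fin n → β ⊕ Fin m), (∀ i, (f (Sum.inr i)).isRight) →
    ∀ b ∈ (ren f φ).freeVarFinset, ∃ a ∈ φ.freeVarFinset, f (Sum.inl a) = Sum.inl b := by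
  induction φ with
  | falsum => intro m f hr b hb; simp [ren] at hb
  | equal s t =>
    intro m f hr b hb
    simp only [ren, BoundedFormula.freeVarFinset, Finset.mem_union] at hb ⊢
    rcases hb with hb | hb
    · obtain ⟨a, ha, h⟩ := Term.varFinsetLeft_relabel_subset f hr s b hb
      exact ⟨a, Or.inl ha, h⟩
    · obtain ⟨a, ha, h⟩ := Term.varFinsetLeft_relabel_subset f hr t b hb
      exact ⟨a, Or.inr ha, h⟩
  | rel R ts =>
    intro m f hr b hb
    simp only [ren, BoundedFormula.freeVarFinset, Finset.mem_biUnion, Finset.mem_univ,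
      true_and] at hb ⊢
    obtain ⟨i, hi⟩ := hb
    obtain ⟨a, ha, h⟩ := Term.varFinsetLeft_relabel_subset f hr (ts i) b hi
    exact ⟨a, ⟨i, ha⟩, h⟩
  | imp φ ψ ih1 ih2 =>
    intro m f hr b hb
    simp only [ren, BoundedFormula.freeVarFinset, Finset.mem_union] at hb ⊢
    rcases hb with hb | hb
    · obtain ⟨a, ha, h⟩ := ih1 f hr b hb
      exact ⟨a, Or.inl ha, h⟩
    · obtain ⟨a, ha, h⟩ := ih2 f hr b hb
      exact ⟨a, Or.inr ha, h⟩
  | all φ ih =>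
    intro m f hr b hb
    simp only [ren, BoundedFormula.freeVarFinset] at hb ⊢
    obtain ⟨a, ha, h⟩ := ih (liftVar f) (fun i => by
      refine Fin.lastCases ?_ (fun j => ?_) i
      · simp [liftVar]
      · have := hr j
        simp only [liftVar, Sum.elim_inr, Fin.lastCases_castSucc]
        rcases hfj : f (Sum.inr j) with b | j <;> simp_all) b hb
    refine ⟨a, ha, ?_⟩
    simp only [liftVar, Sum.elim_inl] at h
    rcases hfa : f (Sum.inl a) with b' | j <;> simp_all

theorem Term.mem_varFinsetLeft_relabel [DecidableEq α] [DecidableEq β] {n m : ℕ}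
    (f : α ⊕ Fin n → β ⊕ Fin m) (t : L.Term (α ⊕ Fin n)) {a : α} {b : β}
    (ha : a ∈ t.varFinsetLeft) (h : f (Sum.inl a) = Sum.inl b) :
    b ∈ (t.relabel f).varFinsetLeft := by
  induction t with
  | var x =>
    rcases x with c | i
    · simp only [Term.varFinsetLeft, Finset.mem_singleton] at ha
      subst ha
      simp [h]
    · simp at ha
  | func F ts ih =>
    simp only [Term.varFinsetLeft, Finset.mem_biUnion, Finset.mem_univ, true_and] at ha
    obtain ⟨i, hi⟩ := ha
    simpa using ⟨i, ih i hi⟩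

theorem mem_freeVarFinset_ren [DecidableEq α] [DecidableEq β] {n : ℕ} (φ : L.BoundedFormula α n) :
    ∀ {m : ℕ} (f : α ⊕ Fin n → β ⊕ Fin m) {a : α} {b : β}, a ∈ φ.freeVarFinset →
      f (Sum.inl a) = Sum.inl b → b ∈ (ren f φ).freeVarFinset := by
  induction φ with
  | falsum => intro m f a b ha; simp at ha
  | equal s t =>
    intro m f a b ha h
    simp only [ren, BoundedFormula.freeVarFinset, Finset.mem_union] at ha ⊢
    exact ha.imp (fun ha => Term.mem_varFinsetLeft_relabel f s ha h)
      fun ha => Term.mem_varFinsetLeft_relabel f t ha h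
  | rel R ts =>
    intro m f a b ha h
    simp only [ren, BoundedFormula.freeVarFinset, Finset.mem_biUnion, Finset.mem_univ,
      true_and] at ha ⊢
    obtain ⟨i, hi⟩ := ha
    exact ⟨i, Term.mem_varFinsetLeft_relabel f (ts i) hi h⟩
  | imp φ ψ ih1 ih2 =>
    intro m f a b ha h
    simp only [ren, BoundedFormula.freeVarFinset, Finset.mem_union] at ha ⊢
    exact ha.imp (fun ha => ih1 f ha h) fun ha => ih2 f ha h
  | all φ ih =>
    intro m f a b ha h
    simp only [ren, BoundedFormula.freeVarFinset] at ha ⊢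
    exact ih (liftVar f) ha (by simp [liftVar, h])

theorem fvars_relabel_subset (φ : L.Formula ℕ) (f : ℕ → ℕ) :
    fvars (φ.relabel f) ⊆ (fvars φ).image f := by
  intro b hb
  rw [Formula.relabel_eq_ren] at hb
  obtain ⟨a, ha, h⟩ := freeVarFinset_ren φ _ (fun i => i.elim0) b hb
  exact Finset.mem_image.2 ⟨a, ha, by simpa using h⟩

/-- Renaming by a permutation commutes with the quantification of a variable, as an identity
between formulas, since bound variables are nameless. -/
theorem exVar_relabel (σ : Equiv.Perm ℕ) (X : ℕ) (φ : L.Formula ℕ) :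
    (exVar X φ).relabel σ = exVar (σ X) (φ.relabel σ) := by
  have h1 : (exVar X φ).relabel σ = BoundedFormula.ex (n := 0)
      (BoundedFormula.relabel (n := 0) (k := 1) (Sum.inl ∘ σ)
        (BoundedFormula.relabel (n := 1) (k := 0)
          (fun Y => if Y = X then Sum.inr 0 else Sum.inl Y) φ)) := by
    unfold exVar Formula.relabel
    exact BoundedFormula.relabel_ex (k := 0) _ _
  rw [h1, Formula.relabel_eq_ren]
  unfold exVar
  congr 1
  rw [relabel_eq_ren, relabel_eq_ren]
  refine (ren_ren _ _ _).trans ?_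
  refine Eq.trans ?_ (relabel_eq_ren (n := 1) (k := 0)
    (fun Y => if Y = σ X then Sum.inr 0 else Sum.inl Y) (ren (m := 0) (Sum.map σ id) φ)).symm
  refine Eq.trans ?_ (ren_ren _ _ _).symm
  congr 1
  funext x
  rcases x with a | i
  · by_cases h : a = X
    · simp [BoundedFormula.relabelAux, h]; rfl
    · simp [BoundedFormula.relabelAux, h]
  · exact i.elim0

theorem realize_exVar {U : Type w} [L.Structure U] (X : ℕ) (φ : L.Formula ℕ) (val : ℕ → U) :
    (exVar X φ).Realize val ↔ ∃ z, φ.Realize (Function.update val X z) := by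
  unfold exVar Formula.Realize
  rw [BoundedFormula.realize_ex]
  refine exists_congr fun z => ?_
  rw [BoundedFormula.realize_relabel]
  refine iff_of_eq (congrArg₂ _ ?_ (Subsingleton.elim _ _))
  funext Y
  by_cases h : Y = X
  · subst h
    simp [Fin.snoc]
  · simp [h]

theorem fvars_exVar (X : ℕ) (φ : L.Formula ℕ) : fvars (exVar X φ) = (fvars φ).erase X := by
  have h1 : fvars (exVar X φ) = (ren (BoundedFormula.relabelAux (n := 1)
      (fun Y => if Y = X then Sum.inr 0 else Sum.inl Y) 0) φ).freeVarFinset := by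
    rw [← relabel_eq_ren]
    simp [fvars, exVar, BoundedFormula.ex, BoundedFormula.not, Bot.bot]
  rw [h1]
  ext b
  rw [Finset.mem_erase]
  constructor
  · intro hb
    obtain ⟨a, ha, h⟩ := freeVarFinset_ren φ _ (fun i => i.elim0) b hb
    by_cases h' : a = X
    · simp [BoundedFormula.relabelAux, h'] at h
    · simp [BoundedFormula.relabelAux, h'] at h
      subst h
      exact ⟨h', ha⟩
  · rintro ⟨hb, hb'⟩
    exact mem_freeVarFinset_ren φ _ hb' (by simp [BoundedFormula.relabelAux, hb])

@[simp] theorem fvars_inf (φ ψ : L.Formula ℕ) : fvars (φ ⊓ ψ) = fvars φ ∪ fvars ψ := by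
  simp [fvars, Min.min, BoundedFormula.not, Bot.bot]

@[simp] theorem fvars_sup (φ ψ : L.Formula ℕ) : fvars (φ ⊔ ψ) = fvars φ ∪ fvars ψ := by
  simp [fvars, Max.max, BoundedFormula.not, Bot.bot]

@[simp] theorem fvars_top : fvars (⊤ : L.Formula ℕ) = ∅ := by
  rfl

theorem fvars_varEq (X Y : ℕ) : fvars (varEq X Y : L.Formula ℕ) = {X, Y} := by
  simp [fvars, varEq, Term.equal, Term.bdEqual]

end Renaming

/-! ### Closure properties of `𝒜^{∃∨}` -/

section ExDisj

variable {L : FirstOrder.Language.{u, v}} {S : Set (L.Formula ℕ)}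

theorem IsDisj.relabel (hS : IsConstraintClass S) (σ : Equiv.Perm ℕ) {φ : L.Formula ℕ}
    (h : IsDisj S φ) : IsDisj S (φ.relabel σ) := by
  induction h with
  | single φ h => exact .single _ (hS.rename_mem σ φ h)
  | sup φ ψ _ _ ih1 ih2 => exact .sup _ _ ih1 ih2

theorem IsExDisj.relabel (hS : IsConstraintClass S) (σ : Equiv.Perm ℕ) {φ : L.Formula ℕ}
    (h : IsExDisj S φ) : IsExDisj S (φ.relabel σ) := by
  induction h with
  | disj φ h => exact .disj _ (h.relabel hS σ)
  | ex X φ _ ih => rw [exVar_relabel]; exact .ex _ _ ih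

theorem IsDisj.exists_inf_mem (hS : IsConstraintClass S) {φ ψ : L.Formula ℕ} (hφ : φ ∈ S)
    (hψ : IsDisj S ψ) (U : Type w) [L.Structure U] :
    ∃ χ, IsDisj S χ ∧ fvars χ ⊆ fvars φ ∪ fvars ψ ∧
      ∀ val : ℕ → U, χ.Realize val ↔ φ.Realize val ∧ ψ.Realize val := by
  induction hψ with
  | single ψ h =>
    exact ⟨φ ⊓ ψ, .single _ (hS.inf_mem φ hφ ψ h), (fvars_inf _ _).subset, fun val =>
      Formula.realize_inf⟩
  | sup ψ₁ ψ₂ _ _ ih1 ih2 =>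
    obtain ⟨χ₁, h1, h1v, h1r⟩ := ih1
    obtain ⟨χ₂, h2, h2v, h2r⟩ := ih2
    refine ⟨χ₁ ⊔ χ₂, .sup _ _ h1 h2, ?_, fun val => ?_⟩
    · rw [fvars_sup, fvars_sup]
      intro X hX
      have := @h1v X
      have := @h2v X
      simp only [Finset.mem_union] at *
      tauto
    · rw [Formula.realize_sup, Formula.realize_sup, h1r, h2r]
      tauto

theorem IsDisj.exists_inf (hS : IsConstraintClass S) {φ ψ : L.Formula ℕ} (hφ : IsDisj S φ)
    (hψ : IsDisj S ψ) (U : Type w) [L.Structure U] :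
    ∃ χ, IsDisj S χ ∧ fvars χ ⊆ fvars φ ∪ fvars ψ ∧
      ∀ val : ℕ → U, χ.Realize val ↔ φ.Realize val ∧ ψ.Realize val := by
  induction hφ with
  | single φ h => exact hψ.exists_inf_mem hS h U
  | sup φ₁ φ₂ _ _ ih1 ih2 =>
    obtain ⟨χ₁, h1, h1v, h1r⟩ := ih1
    obtain ⟨χ₂, h2, h2v, h2r⟩ := ih2
    refine ⟨χ₁ ⊔ χ₂, .sup _ _ h1 h2, ?_, fun val => ?_⟩
    · rw [fvars_sup, fvars_sup]
      intro X hX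
      have := @h1v X
      have := @h2v X
      simp only [Finset.mem_union] at *
      tauto
    · rw [Formula.realize_sup, Formula.realize_sup, h1r, h2r]
      tauto

/-- The step of the prenex transformation: if `φ ∧ ψσ` can be expressed whatever `σ` is, then so
can `φ ∧ (∃ X ψ)σ`, by quantifying over a variable `Y` that is fresh for `φ` and `ψσ`. -/
theorem exists_inf_exVar {φ ψ : L.Formula ℕ} (X : ℕ) {U : Type w} [L.Structure U]
    (ih : ∀ σ : Equiv.Perm ℕ, ∃ χ, IsExDisj S χ ∧ fvars χ ⊆ fvars φ ∪ (fvars ψ).image σ ∧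
      ∀ val : ℕ → U, χ.Realize val ↔ φ.Realize val ∧ ψ.Realize (val ∘ σ)) (σ : Equiv.Perm ℕ) :
    ∃ χ, IsExDisj S χ ∧ fvars χ ⊆ fvars φ ∪ (fvars (exVar X ψ)).image σ ∧
      ∀ val : ℕ → U, χ.Realize val ↔ φ.Realize val ∧ (exVar X ψ).Realize (val ∘ σ) := by
  obtain ⟨Y, hY⟩ := Infinite.exists_notMem_finset (fvars φ ∪ (fvars ψ).image σ)
  rw [Finset.mem_union, not_or] at hY
  obtain ⟨hYφ, hYψ⟩ := hY
  obtain ⟨χ, hχ, hχv, hχr⟩ := ih (σ.trans (Equiv.swap (σ X) Y))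
  have hne : ∀ Z ∈ fvars ψ, Z ≠ X →
      (σ.trans (Equiv.swap (σ X) Y)) Z = σ Z ∧ σ Z ≠ Y := by
    intro Z hZ hZX
    have h1 : σ Z ≠ Y := fun h => hYψ (Finset.mem_image.2 ⟨Z, hZ, h⟩)
    exact ⟨Equiv.swap_apply_of_ne_of_ne (fun h => hZX (σ.injective h)) h1, h1⟩
  refine ⟨exVar Y χ, .ex _ _ hχ, ?_, fun val => ?_⟩
  · intro Z hZ
    have hZ := Finset.mem_erase.1 (fvars_exVar Y χ ▸ hZ)
    rcases Finset.mem_union.1 (hχv hZ.2) with h | h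
    · exact Finset.mem_union_left _ h
    · obtain ⟨W, hW, rfl⟩ := Finset.mem_image.1 h
      refine Finset.mem_union_right _ (Finset.mem_image.2 ⟨W, ?_, ?_⟩)
      · rw [fvars_exVar]
        refine Finset.mem_erase.2 ⟨?_, hW⟩
        rintro rfl
        exact hZ.1 (by simp)
      · refine (hne W hW ?_).1.symm
        rintro rfl
        exact hZ.1 (by simp)
  · rw [realize_exVar, realize_exVar, ← exists_and_left]
    refine exists_congr fun z => ?_
    rw [hχr]
    refine and_congr (realize_congr φ fun Z hZ => ?_) (realize_congr ψ fun Z hZ => ?_)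
    · rw [Function.update_of_ne]
      rintro rfl
      exact hYφ hZ
    · by_cases hZX : Z = X
      · subst hZX
        simp
      · obtain ⟨h1, h2⟩ := hne Z hZ hZX
        rw [Function.comp_apply, h1, Function.update_of_ne h2, Function.update_of_ne hZX]
        rfl

theorem IsExDisj.exists_inf_relabel {U : Type w} [L.Structure U] (hS : IsConstraintClass S)
    {φ ψ : L.Formula ℕ} (hφ : IsDisj S φ) (hψ : IsExDisj S ψ) (σ : Equiv.Perm ℕ) :
    ∃ χ, IsExDisj S χ ∧ fvars χ ⊆ fvars φ ∪ (fvars ψ).image σ ∧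
      ∀ val : ℕ → U, χ.Realize val ↔ φ.Realize val ∧ ψ.Realize (val ∘ σ) := by
  induction hψ generalizing σ with
  | disj ψ h =>
    obtain ⟨χ, hχ, hχv, hχr⟩ := hφ.exists_inf hS (h.relabel hS σ) U
    refine ⟨χ, .disj _ hχ, hχv.trans (Finset.union_subset_union_right
      (fvars_relabel_subset _ _)), fun val => ?_⟩
    rw [hχr, Formula.realize_relabel]
  | ex X ψ _ ih => exact exists_inf_exVar X ih σ

/-- Up to equivalence, `𝒜^{∃∨}` is closed under conjunction. -/
theorem IsExDisj.exists_inf (hS : IsConstraintClass S) {φ ψ : L.Formula ℕ} (hφ : IsExDisj S φ)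
    (hψ : IsExDisj S ψ) (U : Type w) [L.Structure U] :
    ∃ χ, IsExDisj S χ ∧ fvars χ ⊆ fvars φ ∪ fvars ψ ∧
      ∀ val : ℕ → U, χ.Realize val ↔ φ.Realize val ∧ ψ.Realize val := by
  -- the renaming, needed for the induction, is here applied to the other conjunct
  have key : ∀ σ : Equiv.Perm ℕ, ∃ χ, IsExDisj S χ ∧ fvars χ ⊆ fvars ψ ∪ (fvars φ).image σ ∧
      ∀ val : ℕ → U, χ.Realize val ↔ ψ.Realize val ∧ φ.Realize (val ∘ σ) := by
    induction hφ with
    | disj φ h =>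
      intro σ
      obtain ⟨χ, hχ, hχv, hχr⟩ := exists_inf_relabel (U := U) hS (h.relabel hS σ) hψ 1
      refine ⟨χ, hχ, hχv.trans ?_, fun val => ?_⟩
      · rw [Finset.union_comm]
        exact Finset.union_subset_union (by simp) (fvars_relabel_subset _ _)
      · rw [hχr, Formula.realize_relabel, and_comm]
        rfl
    | ex X φ _ ih => exact exists_inf_exVar X ih
  obtain ⟨χ, hχ, hχv, hχr⟩ := key 1
  refine ⟨χ, hχ, ?_, fun val => ?_⟩
  · rw [Finset.union_comm]
    simpa using hχv
  · rw [hχr, and_comm]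
    rfl

end ExDisj

/-! ### Atoms, clauses and valuations -/

section Basics

variable {L : FirstOrder.Language.{u, v}} {Pred : Type x} {ar : Pred → ℕ} {U : Type w}

/-- The predicate symbol of an atom together with the images of its arguments. Equality of such
tuples compares argument lists of atoms whose predicate symbols are only propositionally equal. -/
def Atom.tuple {β : Type*} (f : ℕ → β) (a : Atom ar) : Σ p : Pred, (Fin (ar p) → β) :=
  ⟨a.pred, fun i => f (a.args i)⟩

theorem Atom.mem_vars {a : Atom ar} {X : ℕ} : X ∈ a.vars ↔ ∃ i, a.args i = X := by
  simp [Atom.vars]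

theorem Atom.tuple_comp {β γ : Type*} {a b : Atom ar} {f g : ℕ → β} (h : a.tuple f = b.tuple g)
    (k : β → γ) : a.tuple (k ∘ f) = b.tuple (k ∘ g) :=
  congrArg (fun t : Σ p : Pred, (Fin (ar p) → β) =>
    (⟨t.1, fun i => k (t.2 i)⟩ : Σ p : Pred, (Fin (ar p) → γ))) h

theorem Atom.tuple_congr {β : Type*} {a : Atom ar} {f g : ℕ → β} (h : ∀ X ∈ a.vars, f X = g X) :
    a.tuple f = a.tuple g := by
  unfold Atom.tuple
  congr 1
  funext i
  exact h _ (Atom.mem_vars.2 ⟨i, rfl⟩)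

theorem Atom.eqOn_of_tuple_eq {β : Type*} {a : Atom ar} {f g : ℕ → β} (h : a.tuple f = a.tuple g)
    {X : ℕ} (hX : X ∈ a.vars) : f X = g X := by
  obtain ⟨i, rfl⟩ := Atom.mem_vars.1 hX
  have := (Sigma.mk.inj_iff.1 h).2
  exact congrFun (eq_of_heq this) i

theorem Atom.tuple_rename {β : Type*} (f : ℕ → β) (σ : Equiv.Perm ℕ) (a : Atom ar) :
    (a.rename σ).tuple f = a.tuple (f ∘ σ) := rfl

theorem Atom.vars_rename (σ : Equiv.Perm ℕ) (a : Atom ar) :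
    (a.rename σ).vars = a.vars.image σ := by
  ext X
  simp [Atom.mem_vars, Atom.rename]

theorem Interp.holds_of_tuple_eq {I : Interp ar U} {a b : Atom ar} {val val' : ℕ → U}
    (h : a.tuple val = b.tuple val') : I.Holds val a ↔ I.Holds val' b :=
  iff_of_eq (congrArg (fun t : Σ p : Pred, (Fin (ar p) → U) => I t.1 t.2) h)

theorem Interp.holds_congr {I : Interp ar U} {a : Atom ar} {val val' : ℕ → U}
    (h : ∀ X ∈ a.vars, val X = val' X) : I.Holds val a ↔ I.Holds val' a :=
  Interp.holds_of_tuple_eq (Atom.tuple_congr h)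

theorem Interp.holdsHead_congr {I : Interp ar U} {h : Option (Atom ar)} {val val' : ℕ → U}
    (hv : ∀ a ∈ h, ∀ X ∈ a.vars, val X = val' X) : I.HoldsHead val h ↔ I.HoldsHead val' h := by
  cases h with
  | none => rfl
  | some a => exact Interp.holds_congr (hv a rfl)

theorem Interp.holds_rename {I : Interp ar U} {a : Atom ar} {val : ℕ → U} (σ : Equiv.Perm ℕ) :
    I.Holds val (a.rename σ) ↔ I.Holds (val ∘ σ) a := Iff.rfl

theorem Atom.Inst.tuple_eq {A' A : Atom ar} {θ : ℕ → ℕ} (h : A'.Inst θ A) :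
    A'.tuple θ = A.tuple id := h

theorem Atom.Inst.holds_iff {I : Interp ar U} {A' A : Atom ar} {θ : ℕ → ℕ} (h : A'.Inst θ A)
    (val : ℕ → U) : I.Holds (val ∘ θ) A' ↔ I.Holds val A :=
  Interp.holds_of_tuple_eq (Atom.tuple_comp h.tuple_eq val)

theorem Atom.Inst.mem_vars {A' A : Atom ar} {θ : ℕ → ℕ} (h : A'.Inst θ A) {X : ℕ}
    (hX : X ∈ A'.vars) : θ X ∈ A.vars := by
  obtain ⟨p, v, hv⟩ := A
  obtain ⟨p', v', hv'⟩ := A'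
  obtain ⟨rfl, h⟩ := Sigma.mk.inj_iff.1 h
  obtain rfl := eq_of_heq h
  obtain ⟨i, rfl⟩ := Atom.mem_vars.1 hX
  exact Atom.mem_vars.2 ⟨i, rfl⟩

theorem exists_perm_eqOn (s : Finset ℕ) (f : ℕ → ℕ) (hf : Set.InjOn f s) :
    ∃ σ : Equiv.Perm ℕ, ∀ X ∈ s, σ X = f X := by
  obtain ⟨σ, hσ⟩ := Equiv.Perm.exists_extending_pair (fun X : s => X.1) (fun X : s => f X.1)
    Subtype.val_injective fun X Y h => Subtype.ext (hf X.2 Y.2 h)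
  exact ⟨σ, fun X hX => hσ ⟨X, hX⟩⟩

theorem Atom.exists_rename_eq {a A : Atom ar} (h : a.pred = A.pred) (W F : Finset ℕ) :
    ∃ σ : Equiv.Perm ℕ, a.rename σ = A ∧ ∀ X ∈ W, X ∉ a.vars → σ X ∉ F := by
  obtain ⟨p, v, hv⟩ := a
  obtain ⟨p', v', hv'⟩ := A
  obtain rfl : p = p' := h
  classical
  let a : Atom ar := ⟨p, v, hv⟩
  let A : Atom ar := ⟨p, v', hv'⟩
  -- variables outside the atom are shifted beyond `F` and the variables of the target
  obtain ⟨M, hM⟩ := (F ∪ A.vars).bddAbove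
  let f : ℕ → ℕ := fun X => if h : ∃ i, v i = X then v' h.choose else M + 1 + X
  have hfi : ∀ i, f (v i) = v' i := by
    intro i
    have h : ∃ j, v j = v i := ⟨i, rfl⟩
    simp only [f, dif_pos h]
    rw [hv h.choose_spec]
  have hfn : ∀ X, X ∉ a.vars → f X = M + 1 + X := by
    intro X hX
    have h : ¬ ∃ i, v i = X := fun h => hX (Atom.mem_vars.2 h)
    simp only [f, dif_neg h]
  have hle : ∀ i, v' i ≤ M := fun i => hM (by simp [Atom.mem_vars, A])
  obtain ⟨σ, hσ⟩ := exists_perm_eqOn (W ∪ a.vars) f (by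
    intro X _ Y _ hXY
    by_cases hX : X ∈ a.vars <;> by_cases hY : Y ∈ a.vars
    · obtain ⟨i, rfl⟩ := Atom.mem_vars.1 hX
      obtain ⟨j, rfl⟩ := Atom.mem_vars.1 hY
      change f (v i) = f (v j) at hXY
      rw [hfi, hfi] at hXY
      rw [hv' hXY]
    · obtain ⟨i, rfl⟩ := Atom.mem_vars.1 hX
      change f (v i) = f Y at hXY
      rw [hfi, hfn Y hY] at hXY
      have := hle i
      omega
    · obtain ⟨i, rfl⟩ := Atom.mem_vars.1 hY
      change f X = f (v i) at hXY
      rw [hfi, hfn X hX] at hXY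
      have := hle i
      omega
    · rw [hfn X hX, hfn Y hY] at hXY
      omega)
  refine ⟨σ, ?_, fun X hX hXa hF => ?_⟩
  · unfold Atom.rename
    congr 1
    funext i
    rw [hσ _ (Finset.mem_union_right _ (Atom.mem_vars.2 ⟨i, rfl⟩)), hfi]
  · rw [hσ X (Finset.mem_union_left _ hX), hfn X hXa] at hF
    have := hM (Finset.mem_coe.2 (Finset.mem_union_left _ hF))
    omega

namespace Clause

theorem mem_bodyVars_of_mem {C : Clause L ar} {a : Atom ar} (h : a ∈ C.body) {X : ℕ}
    (hX : X ∈ a.vars) : X ∈ C.bodyVars := Or.inr ⟨a, h, hX⟩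

theorem mem_vars_of_mem {C : Clause L ar} {a : Atom ar} (h : a ∈ C.body) {X : ℕ}
    (hX : X ∈ a.vars) : X ∈ C.vars := Or.inr (mem_bodyVars_of_mem h hX)

theorem mem_vars_of_constr {C : Clause L ar} {X : ℕ} (hX : X ∈ fvars C.constr) : X ∈ C.vars :=
  Or.inr (Or.inl hX)

theorem mem_vars_of_head {C : Clause L ar} {a : Atom ar} (h : a ∈ C.head) {X : ℕ}
    (hX : X ∈ a.vars) : X ∈ C.vars := Or.inl ⟨a, h, hX⟩

theorem finite_bodyVars (C : Clause L ar) : C.bodyVars.Finite := by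
  refine ((fvars C.constr).finite_toSet.union
    ((Multiset.finite_toSet C.body).biUnion fun a _ => a.vars.finite_toSet)).subset ?_
  rintro X (h | ⟨a, ha, h⟩)
  · exact Or.inl h
  · exact Or.inr (Set.mem_biUnion (x := a) ha h)

theorem finite_vars (C : Clause L ar) : C.vars.Finite := by
  refine Set.Finite.union ?_ C.finite_bodyVars
  rcases h : C.head with _ | a
  · refine Set.finite_empty.subset ?_
    rintro X ⟨a, ha, -⟩
    simp [h] at ha
  · refine a.vars.finite_toSet.subset ?_
    rintro X ⟨b, hb, hX⟩
    obtain rfl : a = b := by simpa [h] using hb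
    exact hX

theorem finite_preds (C : Clause L ar) : C.preds.Finite := by
  refine (Set.Finite.union (s := {p | ∃ a ∈ C.head, a.pred = p}) ?_
    ((Multiset.finite_toSet C.body).image Atom.pred)).subset ?_
  · rcases h : C.head with _ | a
    · refine Set.finite_empty.subset ?_
      rintro X ⟨a, ha, -⟩
      simp at ha
    · refine (Set.finite_singleton a.pred).subset ?_
      rintro X ⟨b, hb, rfl⟩
      obtain rfl : a = b := by simpa using hb
      rfl
  · rintro p (h | ⟨a, ha, h⟩)
    · exact Or.inl h
    · exact Or.inr ⟨a, ha, h⟩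

/-- The clause yields its head in `J` from its body in `I`. For `I = J` this is the truth of the
clause in `I`. -/
def Yields [L.Structure U] (C : Clause L ar) (I J : Interp ar U) : Prop :=
  ∀ val : ℕ → U, C.constr.Realize val → (∀ a ∈ C.body, I.Holds val a) → J.HoldsHead val C.head

end Clause

theorem finite_predsOf {P : Set (Clause L ar)} (h : P.Finite) : (predsOf P).Finite := by
  refine (h.biUnion fun C _ => C.finite_preds).subset ?_
  rintro p ⟨C, hC, hp⟩
  exact Set.mem_biUnion hC hp

theorem mem_predsOf_of_head {P : Set (Clause L ar)} {K : Clause L ar} (hK : K ∈ P) {a : Atom ar}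
    (ha : a ∈ K.head) : a.pred ∈ predsOf P := ⟨K, hK, Or.inl ⟨a, ha, rfl⟩⟩

/-- The truth of a clause depends only on the interpretation of its predicate symbols. -/
theorem Clause.Yields.congr [L.Structure U] {C : Clause L ar} {I J : Interp ar U}
    (h : C.Yields I I) (hIJ : ∀ p ∈ C.preds, I p = J p) : C.Yields J J := by
  intro val hc hb
  have h1 := h val hc fun a ha => by
    have := hIJ a.pred (Or.inr ⟨a, ha, rfl⟩)
    have h2 := hb a ha
    unfold Interp.Holds at h2 ⊢
    rwa [this]
  rcases hh : C.head with _ | a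
  · rw [hh] at h1; exact h1
  · rw [hh] at h1
    have := hIJ a.pred (Or.inl ⟨a, hh, rfl⟩)
    simp only [Interp.HoldsHead, Interp.Holds] at h1 ⊢
    rwa [← this]

end Basics

/-! ### Unfolding -/

section Unfolding

variable {L : FirstOrder.Language.{u, v}} {Pred : Type x} {ar : Pred → ℕ} {U : Type w}
variable {P T : Set (Clause L ar)} {C : Clause L ar} {A B : Atom ar}

theorem exists_isUnfolding (P : Set (Clause L ar)) (hA : A ∈ C.body) :
    ∃ T, IsUnfolding P C A T := by
  obtain ⟨G, hG⟩ := Multiset.exists_cons_of_mem hA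
  have h : ∀ K : Clause L ar, ∃ σ : Equiv.Perm ℕ, ∀ a ∈ K.head, a.pred = A.pred →
      (K.rename σ).head = some A ∧ (K.rename σ).bodyVars ∩ C.vars ⊆ A.vars := by
    intro K
    by_cases hK : ∃ a ∈ K.head, a.pred = A.pred
    · obtain ⟨a, ha, hp⟩ := hK
      obtain ⟨σ, hσ, hσ'⟩ := Atom.exists_rename_eq hp K.finite_vars.toFinset C.finite_vars.toFinset
      refine ⟨σ, fun b hb _ => ?_⟩
      obtain rfl : a = b := Option.some.inj (ha.symm.trans hb)
      refine ⟨?_, ?_⟩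
      · rw [show (K.rename σ).head = K.head.map (Atom.rename σ) from rfl, show K.head = some a from ha,
          Option.map_some, hσ]
      · rintro X ⟨hX, hXC⟩
        have h1 : ∃ Y ∈ K.vars, σ Y = X := by
          rcases hX with hX | ⟨b, hb, hX⟩
          · obtain ⟨Y, hY, rfl⟩ := Finset.mem_image.1 (fvars_relabel_subset _ _ hX)
            exact ⟨Y, Clause.mem_vars_of_constr hY, rfl⟩
          · obtain ⟨c, hc, rfl⟩ := Multiset.mem_map.1 hb
            rw [Atom.vars_rename] at hX
            obtain ⟨Y, hY, rfl⟩ := Finset.mem_image.1 hX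
            exact ⟨Y, Clause.mem_vars_of_mem hc hY, rfl⟩
        obtain ⟨Y, hY, rfl⟩ := h1
        by_cases hYa : Y ∈ a.vars
        · rw [← hσ, Atom.vars_rename]
          exact Finset.mem_coe.2 (Finset.mem_image_of_mem _ hYa)
        · exact absurd (C.finite_vars.mem_toFinset.2 hXC)
            (hσ' Y (K.finite_vars.mem_toFinset.2 hY) hYa)
    · exact ⟨1, fun a ha hp => (hK ⟨a, ha, hp⟩).elim⟩
  choose σ hσ using h
  exact ⟨_, G, hG, σ, fun K _ => hσ K, rfl⟩

theorem IsUnfolding.finite (h : IsUnfolding P C A T) (hP : P.Finite) : T.Finite := by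
  obtain ⟨G, -, σ, -, rfl⟩ := h
  refine (hP.image fun K => (⟨C.head, C.constr ⊓ (K.rename (σ K)).constr,
    G + (K.rename (σ K)).body⟩ : Clause L ar)).subset ?_
  rintro E ⟨K, hK, -, rfl⟩
  exact ⟨K, hK, rfl⟩

theorem IsUnfolding.over {S : Set (L.Formula ℕ)} (hS : IsConstraintClass S)
    (h : IsUnfolding P C A T) (hP : Over S P) (hC : C.constr ∈ S) : Over S T := by
  obtain ⟨G, -, σ, -, rfl⟩ := h
  rintro E ⟨K, hK, -, rfl⟩
  exact hS.inf_mem _ hC _ (hS.rename_mem _ _ (hP K hK))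

theorem IsUnfolding.mem_body {D : Atom ar} (h : IsUnfolding P C A T) (hC : C.body = {A, D})
    {E : Clause L ar} (hE : E ∈ T) : D ∈ E.body := by
  obtain ⟨G, hG, σ, -, rfl⟩ := h
  obtain ⟨K, -, -, rfl⟩ := hE
  rw [hC] at hG
  obtain rfl : {D} = G := (Multiset.cons_inj_right A).1 hG
  simp

theorem Clause.Yields.rename [L.Structure U] {I J : Interp ar U} (h : C.Yields I J)
    (σ : Equiv.Perm ℕ) : (C.rename σ).Yields I J := by
  intro val hc hb
  have h1 := h (val ∘ σ) (Formula.realize_relabel.1 hc) fun a ha =>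
    hb _ (Multiset.mem_map_of_mem _ ha)
  unfold Clause.rename
  rcases hh : C.head with _ | a
  · rw [hh] at h1; exact h1
  · rw [hh] at h1; exact h1

/-- Unfolding is a resolution step: its results are consequences of the clauses involved. -/
theorem IsUnfolding.yields [L.Structure U] {I : Interp ar U} (h : IsUnfolding P C A T)
    (hP : I.IsModel P) (hC : C.Yields I I) : ∀ E ∈ T, E.Yields I I := by
  obtain ⟨G, hG, σ, hσ, rfl⟩ := h
  rintro E ⟨K, hK, ⟨a, ha, hp⟩, rfl⟩ val hc hb
  obtain ⟨hc1, hc2⟩ := Formula.realize_inf.1 hc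
  refine hC val hc1 fun b hbC => ?_
  rw [hG, Multiset.mem_cons] at hbC
  rcases hbC with rfl | hbC
  · have h1 := Clause.Yields.rename (hP K hK) (σ K) val hc2 fun b hbK =>
      hb b (Multiset.mem_add.2 (Or.inr hbK))
    rwa [(hσ K hK a ha hp).1] at h1
  · exact hb b (Multiset.mem_add.2 (Or.inl hbC))

/-- The immediate consequences of `I` by the clauses of `P`. -/
def conseq [L.Structure U] (P : Set (Clause L ar)) (I : Interp ar U) : Interp ar U := fun p t =>
  ∃ K ∈ P, ∃ a ∈ K.head, ∃ val : ℕ → U, K.constr.Realize val ∧ (∀ b ∈ K.body, I.Holds val b) ∧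
    a.tuple val = ⟨p, t⟩

theorem holds_conseq [L.Structure U] {I : Interp ar U} {val : ℕ → U} :
    (conseq P I).Holds val A ↔ ∃ K ∈ P, ∃ a ∈ K.head, ∃ val' : ℕ → U, K.constr.Realize val' ∧
      (∀ b ∈ K.body, I.Holds val' b) ∧ a.tuple val' = A.tuple val := Iff.rfl

/-- If the unfolded atom is an immediate consequence of `I`, then the body of one of the resulting
clauses holds, for a valuation of the fresh variables; the new atoms hold in `I`. -/
theorem IsUnfolding.exists_of_holds [L.Structure U] {I : Interp ar U} (h : IsUnfolding P C A T)
    {val : ℕ → U} (hc : C.constr.Realize val) (hA : (conseq P I).Holds val A) :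
    ∃ E ∈ T, ∃ val' : ℕ → U, (∀ X ∈ C.vars, val' X = val X) ∧ ∃ G N, C.body = A ::ₘ G ∧
      E.head = C.head ∧ E.constr.Realize val' ∧ E.body = G + N ∧ ∀ b ∈ N, I.Holds val' b := by
  classical
  obtain ⟨G, hG, σ, hσ, rfl⟩ := h
  obtain ⟨K, hK, a, ha, valK, hcK, hbK, htup⟩ := holds_conseq.1 hA
  have hp : a.pred = A.pred := congrArg Sigma.fst htup
  obtain ⟨hhead, hvars⟩ := hσ K hK a ha hp
  have haA : a.rename (σ K) = A := by
    have h1 : (K.rename (σ K)).head = some (a.rename (σ K)) := by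
      rw [show (K.rename (σ K)).head = K.head.map (Atom.rename (σ K)) from rfl,
        show K.head = some a from ha, Option.map_some]
    exact Option.some.inj (h1.symm.trans hhead)
  let val' : ℕ → U := fun X => if X ∈ C.vars then val X else valK ((σ K).symm X)
  have hval : ∀ X ∈ C.vars, val' X = val X := fun X hX => if_pos hX
  have hbody : ∀ Y, (σ K) Y ∈ (K.rename (σ K)).bodyVars → val' ((σ K) Y) = valK Y := by
    intro Y hY
    by_cases hYC : (σ K) Y ∈ C.vars
    · have h1 : (σ K) Y ∈ A.vars := hvars ⟨hY, hYC⟩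
      rw [hval _ hYC]
      rw [← haA, Atom.vars_rename] at h1
      obtain ⟨Z, hZ, hZY⟩ := Finset.mem_image.1 h1
      obtain rfl := (σ K).injective hZY
      rw [← haA, Atom.tuple_rename] at htup
      exact (Atom.eqOn_of_tuple_eq htup hZ).symm
    · simp only [val', if_neg hYC, Equiv.symm_apply_apply]
  refine ⟨_, ⟨K, hK, ⟨a, ha, hp⟩, rfl⟩, val', hval, G, _, hG, rfl, ?_, rfl, ?_⟩
  · refine Formula.realize_inf.2 ⟨(realize_congr _ fun X hX =>
      hval X (Clause.mem_vars_of_constr hX)).2 hc, ?_⟩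
    refine Formula.realize_relabel.2 ((realize_congr _ fun Y hY => ?_).2 hcK)
    refine hbody Y (Or.inl ?_)
    rw [show (K.rename (σ K)).constr = K.constr.relabel (σ K) from rfl, Formula.relabel_eq_ren]
    exact mem_freeVarFinset_ren _ _ hY rfl
  · intro b hb
    obtain ⟨c, hcb, rfl⟩ := Multiset.mem_map.1 hb
    rw [Interp.holds_rename]
    refine (Interp.holds_congr fun Y hY => ?_).2 (hbK c hcb)
    refine hbody Y (Clause.mem_bodyVars_of_mem hb ?_)
    rw [Atom.vars_rename]
    exact Finset.mem_image_of_mem _ hY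

theorem exists_isDoubleUnfolding (P : Set (Clause L ar)) (hC : C.body = {A, B}) :
    ∃ T, IsDoubleUnfolding P C A B T := by
  classical
  obtain ⟨T₁, h₁⟩ := exists_isUnfolding (A := A) (C := C) P (by simp [hC])
  have h : ∀ E : Clause L ar, ∃ T, E ∈ T₁ → IsUnfolding P E B T := by
    intro E
    by_cases hE : E ∈ T₁
    · obtain ⟨T, hT⟩ := exists_isUnfolding P (h₁.mem_body hC hE)
      exact ⟨T, fun _ => hT⟩
    · exact ⟨∅, fun h => (hE h).elim⟩
  choose f hf using h
  exact ⟨_, T₁, h₁, f, hf, rfl⟩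

theorem IsDoubleUnfolding.finite (h : IsDoubleUnfolding P C A B T) (hP : P.Finite) :
    T.Finite := by
  obtain ⟨T₁, h₁, f, hf, rfl⟩ := h
  exact (h₁.finite hP).biUnion fun E hE => (hf E hE).finite hP

theorem IsDoubleUnfolding.over {S : Set (L.Formula ℕ)} (hS : IsConstraintClass S)
    (h : IsDoubleUnfolding P C A B T) (hP : Over S P) (hC : C.constr ∈ S) : Over S T := by
  obtain ⟨T₁, h₁, f, hf, rfl⟩ := h
  intro E hE
  obtain ⟨E₁, hE₁, hE⟩ := Set.mem_iUnion₂.1 hE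
  exact (hf E₁ hE₁).over hS hP (h₁.over hS hP hC E₁ hE₁) E hE

theorem IsDoubleUnfolding.yields [L.Structure U] {I : Interp ar U}
    (h : IsDoubleUnfolding P C A B T) (hP : I.IsModel P) (hC : C.Yields I I) :
    ∀ E ∈ T, E.Yields I I := by
  obtain ⟨T₁, h₁, f, hf, rfl⟩ := h
  intro E hE
  obtain ⟨E₁, hE₁, hE⟩ := Set.mem_iUnion₂.1 hE
  exact (hf E₁ hE₁).yields hP (h₁.yields hP hC E₁ hE₁) E hE

/-- After unfolding both atoms of its body, a clause can be applied to the immediate consequences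
of `I` as soon as the resulting clauses can be applied to `I` itself. -/
theorem IsDoubleUnfolding.yields_conseq [L.Structure U] {I J : Interp ar U}
    (h : IsDoubleUnfolding P C A B T) (hC : C.body = {A, B}) (hT : ∀ E ∈ T, E.Yields I J) :
    C.Yields (conseq P I) J := by
  obtain ⟨T₁, h₁, f, hf, rfl⟩ := h
  intro val hc hb
  obtain ⟨E₁, hE₁, val₁, hv₁, G₁, N₁, hG₁, hh₁, hc₁, hb₁, hN₁⟩ :=
    h₁.exists_of_holds hc (hb A (by simp [hC]))
  obtain rfl : {B} = G₁ := (Multiset.cons_inj_right A).1 (hC.symm.trans hG₁)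
  have hB : (conseq P I).Holds val₁ B :=
    (Interp.holds_congr fun X hX => hv₁ X (Clause.mem_vars_of_mem (by simp [hC]) hX)).2
      (hb B (by simp [hC]))
  obtain ⟨E₂, hE₂, val₂, hv₂, G₂, N₂, hG₂, hh₂, hc₂, hb₂, hN₂⟩ :=
    (hf E₁ hE₁).exists_of_holds hc₁ hB
  obtain rfl : N₁ = G₂ := (Multiset.cons_inj_right B).1 (hb₁.symm.trans hG₂)
  have h2 := hT E₂ (Set.mem_biUnion hE₁ hE₂) val₂ hc₂ fun b hb' => by
    rw [hb₂, Multiset.mem_add] at hb'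
    rcases hb' with hb' | hb'
    · exact (Interp.holds_congr fun X hX => hv₂ X (Clause.mem_vars_of_mem
        (by rw [hb₁]; exact Multiset.mem_add.2 (Or.inr hb')) hX)).2 (hN₁ b hb')
    · exact hN₂ b hb'
  rw [hh₂, hh₁] at h2
  refine (Interp.holdsHead_congr fun a ha X hX => ?_).1 h2
  rw [hv₂ X (Clause.mem_vars_of_head (by rw [hh₁]; exact ha) hX),
    hv₁ X (Clause.mem_vars_of_head ha hX)]

end Unfolding

/-! ### Folding and the introduction of definitions -/

section Folding

variable {L : FirstOrder.Language.{u, v}} {Pred : Type x} {ar : Pred → ℕ} {U : Type w}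

theorem realize_varEq [L.Structure U] {X Y : ℕ} {val : ℕ → U} :
    (varEq X Y : L.Formula ℕ).Realize val ↔ val X = val Y := by
  simp [varEq, Formula.realize_equal]

theorem realize_conjEqs [L.Structure U] {l : List (ℕ × ℕ)} {val : ℕ → U} :
    (conjEqs l : L.Formula ℕ).Realize val ↔ ∀ z ∈ l, val z.1 = val z.2 := by
  induction l with
  | nil => simp [conjEqs]
  | cons z l ih =>
    have h : (conjEqs (z :: l) : L.Formula ℕ) = varEq z.1 z.2 ⊓ conjEqs l := rfl
    rw [h, Formula.realize_inf, realize_varEq, ih]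
    simp

theorem fvars_conjEqs_subset {l : List (ℕ × ℕ)} {s : Finset ℕ}
    (h : ∀ z ∈ l, z.1 ∈ s ∧ z.2 ∈ s) : fvars (conjEqs l : L.Formula ℕ) ⊆ s := by
  induction l with
  | nil => exact fvars_top.subset.trans (Finset.empty_subset s)
  | cons z l ih =>
    have h' : (conjEqs (z :: l) : L.Formula ℕ) = varEq z.1 z.2 ⊓ conjEqs l := rfl
    rw [h', fvars_inf, fvars_varEq]
    refine Finset.union_subset ?_ (ih fun z hz => h z (List.mem_cons_of_mem _ hz))
    have := h z List.mem_cons_self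
    simp [Finset.insert_subset_iff, this]

theorem IsConstraintClass.varEq_mem {S : Set (L.Formula ℕ)} (hS : IsConstraintClass S) (X Y : ℕ) :
    varEq X Y ∈ S := hS.equal_mem _ _

theorem IsConstraintClass.conjEqs_mem {S : Set (L.Formula ℕ)} (hS : IsConstraintClass S)
    (l : List (ℕ × ℕ)) : conjEqs l ∈ S := by
  induction l with
  | nil => exact hS.top_mem
  | cons z l ih => exact hS.inf_mem _ (hS.varEq_mem _ _) _ ih

theorem mem_eqPairs [L.Structure U] {d : L.Formula ℕ} {A B : Atom ar} {z : ℕ × ℕ} :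
    z ∈ eqPairs U d A B ↔ (z.1 ∈ A.vars ∧ z.2 ∈ B.vars) ∧
      ∀ val : ℕ → U, d.Realize val → val z.1 = val z.2 := by
  simp [eqPairs, Finset.mem_product]

/-- A list of equalities added to a constraint one at a time, without the trivial ones. -/
theorem realize_foldl_varEq [L.Structure U] {ι : Type*} (n m : ι → ℕ) (l : List ι)
    (d : L.Formula ℕ) {val : ℕ → U} :
    (l.foldl (fun φ i => if n i = m i then φ else φ ⊓ varEq (n i) (m i)) d).Realize val ↔
      d.Realize val ∧ ∀ i ∈ l, val (n i) = val (m i) := by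
  induction l generalizing d with
  | nil => simp
  | cons i l ih =>
    rw [List.foldl_cons, ih]
    by_cases h : n i = m i
    · simp [h]
    · rw [if_neg h, Formula.realize_inf, realize_varEq]
      simp [and_assoc]

theorem IsConstraintClass.foldl_varEq_mem {S : Set (L.Formula ℕ)} (hS : IsConstraintClass S)
    {ι : Type*} (n m : ι → ℕ) (l : List ι) {d : L.Formula ℕ} (hd : d ∈ S) :
    l.foldl (fun φ i => if n i = m i then φ else φ ⊓ varEq (n i) (m i)) d ∈ S := by
  induction l generalizing d with
  | nil => exact hd
  | cons i l ih =>
    rw [List.foldl_cons]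
    apply ih
    by_cases h : n i = m i
    · rwa [if_pos h]
    · rw [if_neg h]
      exact hS.inf_mem _ hd _ (hS.varEq_mem _ _)

variable {V : Set ℕ} {H : Option (Atom ar)} {d : L.Formula ℕ} {A B K : Atom ar}
  {G : Multiset (Atom ar)} {θ : ℕ → ℕ} {D E' : Clause L ar}

theorem exists_isReplaced (hV : V.Finite) (H : Option (Atom ar)) (d : L.Formula ℕ)
    (G : Multiset (Atom ar)) (K : Atom ar) (θ : ℕ → ℕ) : ∃ E', IsReplaced V H d G K θ E' := by
  classical
  obtain ⟨M, hM⟩ := (hV.toFinset ∪ K.vars.image θ).bddAbove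
  have hK : ∀ i, θ (K.args i) ≤ M := fun i => hM (Finset.mem_coe.2 (Finset.mem_union_right _
    (Finset.mem_image_of_mem _ (Atom.mem_vars.2 ⟨i, rfl⟩))))
  let N : Fin (ar K.pred) → ℕ := fun i =>
    if ∃ j < i, θ (K.args j) = θ (K.args i) then M + 1 + i else θ (K.args i)
  have hN : Function.Injective N := by
    intro i j hij
    simp only [N] at hij
    have h1 := hK i
    have h2 := hK j
    split_ifs at hij with hi hj hj
    · exact Fin.ext (by omega)
    · omega
    · omega
    · rcases lt_trichotomy i j with h | h | h
      · exact (hj ⟨i, h, hij⟩).elim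
      · exact h
      · exact (hi ⟨j, h, hij.symm⟩).elim
  refine ⟨_, N, hN, fun i hi => ?_, fun i hi hiV => ?_, rfl⟩
  · simp only [N]
    rw [if_neg]
    rintro ⟨j, hj, h⟩
    exact hi j hj h
  · simp only [N, if_pos hi] at hiV
    have := hM (Finset.mem_coe.2 (Finset.mem_union_left _ (hV.mem_toFinset.2 hiV)))
    omega

theorem IsReplaced.constr_mem {S : Set (L.Formula ℕ)} (hS : IsConstraintClass S)
    (h : IsReplaced V H d G K θ E') (hd : d ∈ S) : E'.constr ∈ S := by
  obtain ⟨N, hN, -, -, rfl⟩ := h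
  exact hS.foldl_varEq_mem _ _ _ hd

theorem IsReplaced.card_body (h : IsReplaced V H d G K θ E') : E'.body.card = G.card + 1 := by
  obtain ⟨N, hN, -, -, rfl⟩ := h
  simp

/-- The head of `D` holds in `I` exactly when its body does. -/
def Defines [L.Structure U] (I : Interp ar U) (D : Clause L ar) : Prop :=
  ∀ N ∈ D.head, ∀ val : ℕ → U,
    I.Holds val N ↔ D.constr.Realize val ∧ ∀ b ∈ D.body, I.Holds val b

theorem Defines.yields [L.Structure U] {I : Interp ar U} (h : Defines I D)
    (hh : D.head.isSome) : D.Yields I I := by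
  intro val hc hb
  obtain ⟨N, hN⟩ := Option.isSome_iff_exists.1 hh
  rw [hN]
  exact (h N hN val).2 ⟨hc, hb⟩

/-- Folding preserves truth in the interpretations in which `D` is a definition. -/
theorem IsReplaced.yields_of_defines [L.Structure U] {𝒞 : Set (L.Formula ℕ)} {I : Interp ar U}
    (h : IsReplaced V H d G K θ E') (hf : CanFold 𝒞 U H d A B G D θ) (hK : D.head = some K)
    (hD : Defines I D) (hE : (⟨H, d, A ::ₘ B ::ₘ G⟩ : Clause L ar).Yields I I) :
    E'.Yields I I := by
  obtain ⟨N, hN, -, -, rfl⟩ := h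
  obtain ⟨⟨A', B', hbody, hA, hB⟩, -, -⟩ := hf
  intro val hc hb
  obtain ⟨hd, hN'⟩ := (realize_foldl_varEq N (fun i => θ (K.args i)) _ d).1 hc
  have h1 : I.Holds (val ∘ θ) K := by
    have h2 := hb _ (Multiset.mem_cons_self _ _)
    have h3 : (fun i => val (N i)) = fun i => (val ∘ θ) (K.args i) :=
      funext fun i => hN' i (List.mem_finRange i)
    unfold Interp.Holds at h2 ⊢
    rwa [← h3]
  have h2 := ((hD K hK _).1 h1).2
  refine hE val hd fun b hb' => ?_
  rcases Multiset.mem_cons.1 hb' with rfl | hb'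
  · exact (hA.holds_iff val).1 (h2 A' (by simp [hbody]))
  rcases Multiset.mem_cons.1 hb' with rfl | hb'
  · exact (hB.holds_iff val).1 (h2 B' (by simp [hbody]))
  · exact hb b (Multiset.mem_cons_of_mem hb')

/-- Conversely, if the definition used for folding is true in `I`, the clause obtained by folding is
applicable whenever the original clause is. -/
theorem IsReplaced.yields_of_folded [L.Structure U] {𝒞 : Set (L.Formula ℕ)} {I J : Interp ar U}
    (h : IsReplaced (⟨H, d, A ::ₘ B ::ₘ G⟩ : Clause L ar).vars H d G K θ E')
    (hf : CanFold 𝒞 U H d A B G D θ) (hK : D.head = some K)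
    (hKv : ∀ X ∈ K.vars, ∃ b ∈ D.body, X ∈ b.vars) (hD : D.Yields I I)
    (hE' : E'.Yields I J) : (⟨H, d, A ::ₘ B ::ₘ G⟩ : Clause L ar).Yields I J := by
  classical
  obtain ⟨N, hN, hN1, hN2, rfl⟩ := h
  obtain ⟨⟨A', B', hbody, hA, hB⟩, ⟨e, -, he⟩, -⟩ := hf
  set E : Clause L ar := ⟨H, d, A ::ₘ B ::ₘ G⟩ with hEdef
  intro val hd hb
  have hθ : ∀ i, θ (K.args i) ∈ E.vars := by
    intro i
    obtain ⟨b, hbD, hX⟩ := hKv _ (Atom.mem_vars.2 ⟨i, rfl⟩)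
    rw [hbody] at hbD
    rcases Multiset.mem_cons.1 hbD with rfl | hbD
    · exact Clause.mem_vars_of_mem (by simp [hEdef]) (hA.mem_vars hX)
    · rw [Multiset.mem_singleton] at hbD
      subst hbD
      exact Clause.mem_vars_of_mem (by simp [hEdef]) (hB.mem_vars hX)
  have hKI : I.Holds (val ∘ θ) K := by
    have h1 := hD (val ∘ θ) (Formula.realize_relabel.1 ((he val).1 hd).2) fun b hbD => by
      rw [hbody] at hbD
      rcases Multiset.mem_cons.1 hbD with rfl | hbD
      · exact (hA.holds_iff val).2 (hb A (by simp [hEdef]))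
      · rw [Multiset.mem_singleton] at hbD
        subst hbD
        exact (hB.holds_iff val).2 (hb B (by simp [hEdef]))
    rwa [hK] at h1
  -- the fresh variables get the values of the arguments that they replace
  let val' : ℕ → U := fun X =>
    if X ∈ E.vars then val X else if h : ∃ i, N i = X then val (θ (K.args h.choose)) else val X
  have hv : ∀ X ∈ E.vars, val' X = val X := fun X hX => if_pos hX
  have hvN : ∀ i, val' (N i) = val (θ (K.args i)) := by
    intro i
    by_cases hi : N i ∈ E.vars
    · rw [hv _ hi, hN1 i]
      intro j hj hij
      exact hN2 i ⟨j, hj, hij⟩ hi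
    · have hex : ∃ j, N j = N i := ⟨i, rfl⟩
      simp only [val', if_neg hi, dif_pos hex]
      rw [hN hex.choose_spec]
  have h1 := hE' val' ((realize_foldl_varEq N (fun i => θ (K.args i)) _ d).2
    ⟨(realize_congr _ fun X hX => hv X (Clause.mem_vars_of_constr hX)).2 hd,
      fun i _ => by rw [hvN, hv _ (hθ i)]⟩) fun b hb' => by
    rcases Multiset.mem_cons.1 hb' with rfl | hb'
    · have h3 : (fun i => val' (N i)) = fun i => (val ∘ θ) (K.args i) := funext hvN
      unfold Interp.Holds at hKI ⊢
      rwa [← h3] at hKI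
    · have hbE : b ∈ E.body := by simp [hEdef, hb']
      exact (Interp.holds_congr fun X hX => hv X (Clause.mem_vars_of_mem hbE hX)).2 (hb b hbE)
  exact (Interp.holdsHead_congr fun a ha X hX => hv X (Clause.mem_vars_of_head ha hX)).1 h1

theorem yields_newDef_of_defines [L.Structure U] {I : Interp ar U} {N : Atom ar} {e : L.Formula ℕ}
    (hD : Defines I (⟨some N, e, {A, B}⟩ : Clause L ar))
    (hE : (⟨H, d, A ::ₘ B ::ₘ G⟩ : Clause L ar).Yields I I) :
    (⟨H, d, N ::ₘ G⟩ : Clause L ar).Yields I I := by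
  intro val hd hb
  have h2 := ((hD N rfl val).1 (hb N (Multiset.mem_cons_self _ _))).2
  refine hE val hd fun b hb' => ?_
  rcases Multiset.mem_cons.1 hb' with rfl | hb'
  · exact h2 b (by simp)
  rcases Multiset.mem_cons.1 hb' with rfl | hb'
  · exact h2 b (by simp)
  · exact hb b (Multiset.mem_cons_of_mem hb')

theorem yields_of_newDef [L.Structure U] {I J : Interp ar U} {N : Atom ar} {e : L.Formula ℕ}
    (hD : (⟨some N, e, {A, B}⟩ : Clause L ar).Yields I I)
    (he : ∀ val : ℕ → U, d.Realize val → e.Realize val)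
    (hE' : (⟨H, d, N ::ₘ G⟩ : Clause L ar).Yields I J) :
    (⟨H, d, A ::ₘ B ::ₘ G⟩ : Clause L ar).Yields I J := by
  intro val hd hb
  refine hE' val hd fun b hb' => ?_
  rcases Multiset.mem_cons.1 hb' with rfl | hb'
  · refine hD val (he val hd) fun b hb' => hb b ?_
    simp only [Multiset.insert_eq_cons, Multiset.mem_cons, Multiset.mem_singleton] at hb'
    rcases hb' with rfl | rfl <;> simp
  · exact hb b (by simp [hb'])

/-- The shape of a pair of atoms under a constraint: the two predicate symbols, the pairs of
argument positions occupied by the same variable, and those whose equality is implied. There are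
finitely many shapes, and pairs of the same shape can be folded by the same definition. Shared
variables matter because a substitution cannot separate them. -/
def shape (U : Type w) [L.Structure U] (d : L.Formula ℕ) (A B : Atom ar) :
    Pred × Pred × Set (ℕ × ℕ) × Set (ℕ × ℕ) :=
  (A.pred, B.pred,
    {z | ∃ (i : Fin (ar A.pred)) (j : Fin (ar B.pred)), z = (i.1, j.1) ∧ A.args i = B.args j},
    {z | ∃ (i : Fin (ar A.pred)) (j : Fin (ar B.pred)), z = (i.1, j.1) ∧
      ∀ val : ℕ → U, d.Realize val → val (A.args i) = val (B.args j)})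

/-- The possible shapes of a pair of atoms with predicate symbols in `S` and in `S'`. -/
def shapes (ar : Pred → ℕ) (S S' : Set Pred) : Set (Pred × Pred × Set (ℕ × ℕ) × Set (ℕ × ℕ)) :=
  {κ | κ.1 ∈ S ∧ κ.2.1 ∈ S' ∧ (∀ z ∈ κ.2.2.1, z.1 < ar κ.1 ∧ z.2 < ar κ.2.1) ∧
    ∀ z ∈ κ.2.2.2, z.1 < ar κ.1 ∧ z.2 < ar κ.2.1}

theorem finite_shapes {S S' : Set Pred} (hS : S.Finite) (hS' : S'.Finite) :
    (shapes ar S S').Finite := by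
  obtain ⟨m, hm⟩ := (hS.image ar).bddAbove
  obtain ⟨m', hm'⟩ := (hS'.image ar).bddAbove
  have hfin : (Set.Iio m ×ˢ Set.Iio m').Finite := (Set.finite_Iio m).prod (Set.finite_Iio m')
  refine (hS.prod (hS'.prod (hfin.powerset.prod hfin.powerset))).subset ?_
  rintro κ ⟨h1, h2, h3, h4⟩
  have h1' := hm (Set.mem_image_of_mem ar h1)
  have h2' := hm' (Set.mem_image_of_mem ar h2)
  exact ⟨h1, h2, fun z hz => ⟨(h3 z hz).1.trans_le h1', (h3 z hz).2.trans_le h2'⟩,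
    fun z hz => ⟨(h4 z hz).1.trans_le h1', (h4 z hz).2.trans_le h2'⟩⟩

theorem shape_mem_shapes [L.Structure U] {S S' : Set Pred} (hA : A.pred ∈ S) (hB : B.pred ∈ S') :
    shape U d A B ∈ shapes ar S S' := by
  refine ⟨hA, hB, ?_, ?_⟩
  · rintro z ⟨i, j, rfl, -⟩
    exact ⟨i.2, j.2⟩
  · rintro z ⟨i, j, rfl, -⟩
    exact ⟨i.2, j.2⟩

/-- A definition whose constraint collects the implied equalities of its pair of atoms can be used
to fold every pair of atoms of the same shape. -/
theorem canFold_of_shape_eq [L.Structure U] {𝒞 : Set (L.Formula ℕ)} {A' B' : Atom ar}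
    (hd : d ∈ 𝒞) (hbody : D.body = {A', B'}) (hvars : D.bodyVars ⊆ D.headVars)
    (hconstr : ∃ l : List (ℕ × ℕ), D.constr = conjEqs l ∧ l.toFinset = eqPairs U D.constr A' B')
    (hs : shape U D.constr A' B' = shape U d A B) :
    ∃ θ, CanFold 𝒞 U H d A B G D θ := by
  classical
  obtain ⟨p, a, ha⟩ := A
  obtain ⟨q, b, hb⟩ := B
  obtain ⟨p', a', ha'⟩ := A'
  obtain ⟨q', b', hb'⟩ := B'
  obtain rfl : p' = p := congrArg Prod.fst hs
  obtain rfl : q' = q := congrArg (fun κ => κ.2.1) hs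
  have hs1 : ∀ i j, a' i = b' j → a i = b j := by
    intro i j h
    have h1 : ((i.1, j.1) : ℕ × ℕ) ∈ (shape U D.constr ⟨p', a', ha'⟩ ⟨q', b', hb'⟩).2.2.1 :=
      ⟨i, j, rfl, h⟩
    rw [hs] at h1
    obtain ⟨i', j', hij, h⟩ := h1
    obtain ⟨hi, hj⟩ := Prod.mk.inj hij
    obtain rfl := Fin.ext hi
    obtain rfl := Fin.ext hj
    exact h
  have hs2 : ∀ i j, (∀ val : ℕ → U, D.constr.Realize val → val (a' i) = val (b' j)) →
      ∀ val : ℕ → U, d.Realize val → val (a i) = val (b j) := by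
    intro i j h
    have h1 : ((i.1, j.1) : ℕ × ℕ) ∈ (shape U D.constr ⟨p', a', ha'⟩ ⟨q', b', hb'⟩).2.2.2 :=
      ⟨i, j, rfl, h⟩
    rw [hs] at h1
    obtain ⟨i', j', hij, h⟩ := h1
    obtain ⟨hi, hj⟩ := Prod.mk.inj hij
    obtain rfl := Fin.ext hi
    obtain rfl := Fin.ext hj
    exact h
  let θ : ℕ → ℕ := fun X => if h : ∃ i, a' i = X then a h.choose else
    if h : ∃ j, b' j = X then b h.choose else X
  have hθa : ∀ i, θ (a' i) = a i := by
    intro i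
    have h : ∃ j, a' j = a' i := ⟨i, rfl⟩
    simp only [θ, dif_pos h]
    rw [ha' h.choose_spec]
  have hθb : ∀ j, θ (b' j) = b j := by
    intro j
    by_cases h : ∃ i, a' i = b' j
    · obtain ⟨i, hi⟩ := h
      rw [← hi, hθa, hs1 i j hi]
    · have h' : ∃ i, b' i = b' j := ⟨j, rfl⟩
      simp only [θ, dif_neg h, dif_pos h']
      rw [hb' h'.choose_spec]
  refine ⟨θ, ⟨_, _, hbody, ?_, ?_⟩, ⟨d, hd, fun val => ?_⟩, ?_⟩
  · unfold Atom.Inst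
    congr 1
    exact funext hθa
  · unfold Atom.Inst
    congr 1
    exact funext hθb
  · refine ⟨fun h => ⟨h, ?_⟩, And.left⟩
    obtain ⟨l, hl, hl'⟩ := hconstr
    rw [Formula.realize_relabel, hl, realize_conjEqs]
    intro z hz
    rw [← List.mem_toFinset, hl', mem_eqPairs] at hz
    obtain ⟨⟨h1, h2⟩, h3⟩ := hz
    obtain ⟨i, hi⟩ := Atom.mem_vars.1 h1
    obtain ⟨j, hj⟩ := Atom.mem_vars.1 h2
    change a' i = z.1 at hi
    change b' j = z.2 at hj
    rw [← hi, ← hj] at h3 ⊢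
    rw [Function.comp_apply, Function.comp_apply, hθa, hθb]
    exact hs2 i j h3 val h
  · rintro X ⟨hX, hX'⟩
    exact (hX' (hvars hX)).elim

/-- The implied equalities of a pair of atoms are also those implied by their conjunction. -/
theorem eqPairs_conjEqs [L.Structure U] {l : List (ℕ × ℕ)} (hl : l.toFinset = eqPairs U d A B) :
    eqPairs U (conjEqs l : L.Formula ℕ) A B = eqPairs U d A B := by
  ext z
  constructor
  · intro hz
    rw [mem_eqPairs] at hz ⊢
    refine ⟨hz.1, fun val h => hz.2 val (realize_conjEqs.2 fun y hy => ?_)⟩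
    rw [← List.mem_toFinset, hl, mem_eqPairs] at hy
    exact hy.2 val h
  · intro hz
    refine mem_eqPairs.2 ⟨(mem_eqPairs.1 hz).1, fun val h => realize_conjEqs.1 h z ?_⟩
    rwa [← List.mem_toFinset, hl]

theorem shape_congr [L.Structure U] {e : L.Formula ℕ} (h : eqPairs U e A B = eqPairs U d A B) :
    shape U e A B = shape U d A B := by
  have h1 : ∀ i j, (∀ val : ℕ → U, e.Realize val → val (A.args i) = val (B.args j)) ↔
      ∀ val : ℕ → U, d.Realize val → val (A.args i) = val (B.args j) := by
    intro i j
    have h2 := Finset.ext_iff.1 h (A.args i, B.args j)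
    rw [mem_eqPairs, mem_eqPairs] at h2
    have h3 : A.args i ∈ A.vars ∧ B.args j ∈ B.vars :=
      ⟨Atom.mem_vars.2 ⟨i, rfl⟩, Atom.mem_vars.2 ⟨j, rfl⟩⟩
    simpa [h3] using h2
  unfold shape
  simp only [h1]

end Folding

/-! ### The invariant of the strategy -/

section Invariant

variable {L : FirstOrder.Language.{u, v}} {Pred : Type x} {ar : Pred → ℕ}

/-- `D` is a definition `N ← e, A, B` of the kind introduced by the strategy. -/
structure IsDefn (U : Type w) [L.Structure U] (Q R : Set (Clause L ar)) (D : Clause L ar)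
    (N A B : Atom ar) : Prop where
  head : D.head = some N
  body : D.body = {A, B}
  fresh : N.pred ∉ predsOf Q ∪ predsOf R
  predA : A.pred ∈ predsOf Q
  predB : B.pred ∈ predsOf R
  vars : N.vars = A.vars ∪ B.vars
  constr : ∃ l : List (ℕ × ℕ), D.constr = conjEqs l ∧ l.toFinset = eqPairs U D.constr A B

/-- In all `𝔻`-models of `P` in which every `D ∈ defs` is a definition, the clauses of `T` are
true. -/
def Sound (U : Type w) [L.Structure U] (P defs T : Set (Clause L ar)) : Prop :=
  ∀ I : Interp ar U, I.IsModel P → (∀ D ∈ defs, Defines I D) → I.IsModel T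

/-- The clauses of `T` simulate `C`: if they can be applied to the atoms that hold in `I`, then `C`
can be applied to the immediate consequences of `I` by the clauses of `P`. Here `J` is the
interpretation in which the heads are derived. -/
def Simulates (U : Type w) [L.Structure U] (P defs T : Set (Clause L ar)) (C : Clause L ar) :
    Prop :=
  ∀ I J : Interp ar U, (∀ D ∈ defs, D.Yields I I) → (∀ E ∈ T, E.Yields I J) →
    C.Yields (conseq P I) J

/-- The invariant of the strategy. -/
structure Inv (𝒞 : Set (L.Formula ℕ)) (U : Type w) [L.Structure U] (Cinit : Clause L ar)
    (Q R : Set (Clause L ar)) (s : State L ar) : Prop where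
  finite_inCls : s.inCls.Finite
  finite_defs : s.defs.Finite
  finite_transfCls : s.transfCls.Finite
  inCls_subset : s.inCls ⊆ insert Cinit s.defs
  isDefn : ∀ D ∈ s.defs, ∃ N A B, IsDefn U Q R D N A B
  head_unique : ∀ D ∈ s.defs, ∀ D' ∈ s.defs, ∀ N ∈ D.head, ∀ N' ∈ D'.head, N.pred = N'.pred →
    D = D'
  shape_injOn : ∃ f : Clause L ar → Pred × Pred × Set (ℕ × ℕ) × Set (ℕ × ℕ), Set.InjOn f s.defs ∧
    ∀ D ∈ s.defs, ∃ N A B, IsDefn U Q R D N A B ∧ f D = shape U D.constr A B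
  subset_transfCls : Q ∪ R ⊆ s.transfCls
  sound : Sound U ({Cinit} ∪ Q ∪ R) s.defs s.transfCls
  simulates : ∀ C ∈ insert Cinit s.defs, C ∉ s.inCls → Simulates U (Q ∪ R) s.defs s.transfCls C
  current : ∀ c ∈ s.current, c.1 ∈ s.inCls ∧ c.2.Finite ∧ Over 𝒞 c.2 ∧
    Sound U ({Cinit} ∪ Q ∪ R) s.defs c.2 ∧ Simulates U (Q ∪ R) s.defs c.2 c.1

variable {𝒞 : Set (L.Formula ℕ)} {U : Type w} [L.Structure U] {Cinit : Clause L ar}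
  {P Q R T T' defs defs' : Set (Clause L ar)} {s t : State L ar}

theorem Sound.mono (h : Sound U P defs T) (hd : defs ⊆ defs') : Sound U P defs' T :=
  fun I hI hD => h I hI fun D hD' => hD D (hd hD')

theorem Simulates.mono {C : Clause L ar} (h : Simulates U P defs T C) (hd : defs ⊆ defs')
    (hT : T ⊆ T') : Simulates U P defs' T' C :=
  fun I J hD hE => h I J (fun D hD' => hD D (hd hD')) fun E hE' => hE E (hT hE')

/-- Replacing the clause `E` by `E'` in a sound set. -/
theorem Sound.replace {E E' : Clause L ar} (h : Sound U P defs T) (hE : E ∈ T)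
    (hd : defs ⊆ defs')
    (h' : ∀ I : Interp ar U, (∀ D ∈ defs', Defines I D) → E.Yields I I → E'.Yields I I) :
    Sound U P defs' ((T \ {E}) ∪ {E'}) := by
  intro I hI hD F hF
  have h1 := h I hI fun D hD' => hD D (hd hD')
  rcases hF with hF | rfl
  · exact h1 F hF.1
  · exact h' I hD (h1 E hE)

theorem Simulates.replace {C E E' : Clause L ar} (h : Simulates U P defs T C) (hd : defs ⊆ defs')
    (h' : ∀ I J : Interp ar U, (∀ D ∈ defs', D.Yields I I) → E'.Yields I J → E.Yields I J) :
    Simulates U P defs' ((T \ {E}) ∪ {E'}) C := by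
  intro I J hD hF
  refine h I J (fun D hD' => hD D (hd hD')) fun F hFT => ?_
  by_cases hFE : F = E
  · subst hFE
    exact h' I J hD (hF E' (Or.inr rfl))
  · exact hF F (Or.inl ⟨hFT, hFE⟩)

theorem IsDefn.isSome {D : Clause L ar} {N A B : Atom ar} (h : IsDefn U Q R D N A B) :
    D.head.isSome := by simp [h.head]

theorem IsDefn.vars_body {D : Clause L ar} {N A B : Atom ar} (h : IsDefn U Q R D N A B) :
    ∀ X ∈ N.vars, ∃ b ∈ D.body, X ∈ b.vars := by
  intro X hX
  rw [h.vars, Finset.mem_union] at hX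
  rcases hX with hX | hX
  · exact ⟨A, by simp [h.body], hX⟩
  · exact ⟨B, by simp [h.body], hX⟩

theorem IsDefn.mem_vars_of_body {D : Clause L ar} {N A B : Atom ar} (h : IsDefn U Q R D N A B)
    {b : Atom ar} (hb : b ∈ D.body) {X : ℕ} (hX : X ∈ b.vars) : X ∈ N.vars := by
  rw [h.body] at hb
  rw [h.vars, Finset.mem_union]
  simp only [Multiset.insert_eq_cons, Multiset.mem_cons, Multiset.mem_singleton] at hb
  rcases hb with rfl | rfl
  · exact Or.inl hX
  · exact Or.inr hX

theorem IsDefn.fvars_constr {D : Clause L ar} {N A B : Atom ar} (h : IsDefn U Q R D N A B) :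
    fvars D.constr ⊆ N.vars := by
  obtain ⟨l, hl, hl'⟩ := h.constr
  rw [h.vars]
  rw [hl]
  refine fvars_conjEqs_subset fun z hz => ?_
  rw [← List.mem_toFinset, hl', mem_eqPairs] at hz
  exact ⟨Finset.mem_union_left _ hz.1.1, Finset.mem_union_right _ hz.1.2⟩

theorem IsDefn.bodyVars_subset {D : Clause L ar} {N A B : Atom ar} (h : IsDefn U Q R D N A B) :
    D.bodyVars ⊆ D.headVars := by
  rintro X (hX | ⟨b, hb, hX⟩)
  · exact ⟨N, h.head, h.fvars_constr hX⟩
  · exact ⟨N, h.head, h.mem_vars_of_body hb hX⟩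

theorem IsDefn.pred_of_body {D : Clause L ar} {N A B : Atom ar} (h : IsDefn U Q R D N A B)
    {b : Atom ar} (hb : b ∈ D.body) : b.pred ∈ predsOf Q ∪ predsOf R := by
  rw [h.body] at hb
  simp only [Multiset.insert_eq_cons, Multiset.mem_cons, Multiset.mem_singleton] at hb
  rcases hb with rfl | rfl
  · exact Or.inl h.predA
  · exact Or.inr h.predB

theorem IsDefn.constr_mem (h𝒞 : IsConstraintClass 𝒞) {D : Clause L ar} {N A B : Atom ar}
    (h : IsDefn U Q R D N A B) : D.constr ∈ 𝒞 := by
  obtain ⟨l, hl, -⟩ := h.constr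
  rw [hl]
  exact h𝒞.conjEqs_mem l

theorem isDefn_newDef {d : L.Formula ℕ} {N A B : Atom ar} {l : List (ℕ × ℕ)}
    (hfresh : N.pred ∉ predsOf Q ∪ predsOf R) (hA : A.pred ∈ predsOf Q) (hB : B.pred ∈ predsOf R)
    (hv : N.vars = A.vars ∪ B.vars) (hl : l.toFinset = eqPairs U d A B) :
    IsDefn U Q R (⟨some N, conjEqs l, {A, B}⟩ : Clause L ar) N A B :=
  ⟨rfl, rfl, hfresh, hA, hB, hv, l, rfl, by rw [eqPairs_conjEqs hl, hl]⟩

theorem inv_initState (p : Pred) (hQfin : Q.Finite) (hRfin : R.Finite) :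
    Inv 𝒞 U Cinit Q R (initState Cinit Q R) where
  finite_inCls := Set.finite_singleton _
  finite_defs := Set.finite_empty
  finite_transfCls := hQfin.union hRfin
  inCls_subset := by simp [initState]
  isDefn := by simp [initState]
  head_unique := by simp [initState]
  shape_injOn := ⟨fun _ => (p, p, ∅, ∅), by simp [initState]⟩
  subset_transfCls := subset_rfl
  sound := fun I hI _ E hE => hI E (by
    rcases hE with hE | hE
    · exact Or.inl (Or.inr hE)
    · exact Or.inr hE)
  simulates := fun C hC hC' => by
    simp [initState] at hC hC'
    exact (hC' hC).elim
  current := by simp [initState]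

theorem Inv.unfold {inCls defs transf : Set (Clause L ar)} {C : Clause L ar} {A B : Atom ar}
    (h : Inv 𝒞 U Cinit Q R ⟨none, inCls, defs, transf⟩) (h𝒞 : IsConstraintClass 𝒞)
    (hCinit : Cinit.constr ∈ 𝒞) (hQfin : Q.Finite) (hRfin : R.Finite) (hQ : Over 𝒞 Q)
    (hR : Over 𝒞 R) (hC : OuterCond Q R inCls C A B)
    (hT : IsDoubleUnfolding (Q ∪ R) C A B T) :
    Inv 𝒞 U Cinit Q R ⟨some (C, T), inCls, defs, transf⟩ where
  __ := h
  current := by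
    intro c hc
    obtain rfl := Option.some.inj hc
    have hC' := h.inCls_subset hC.1
    refine ⟨hC.1, hT.finite (hQfin.union hRfin), hT.over h𝒞 ?_ ?_, ?_, ?_⟩
    · rintro K (hK | hK)
      · exact hQ K hK
      · exact hR K hK
    · rcases hC' with rfl | hD
      · exact hCinit
      · obtain ⟨N, A', B', hD⟩ := h.isDefn C hD
        exact hD.constr_mem h𝒞
    · intro I hI hD
      refine hT.yields (fun K hK => hI K ?_) ?_
      · rcases hK with hK | hK
        · exact Or.inl (Or.inr hK)
        · exact Or.inr hK
      · rcases hC' with rfl | hD'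
        · exact hI C (Or.inl (Or.inl rfl))
        · obtain ⟨N, A', B', hN⟩ := h.isDefn C hD'
          exact (hD C hD').yields hN.isSome
    · intro I J _ hE
      exact hT.yields_conseq hC.2.1 hE

theorem Inv.fold {inCls defs transf : Set (Clause L ar)} {C D E' : Clause L ar}
    {H : Option (Atom ar)} {d : L.Formula ℕ} {A B K : Atom ar} {G : Multiset (Atom ar)}
    {θ : ℕ → ℕ} (h : Inv 𝒞 U Cinit Q R ⟨some (C, T), inCls, defs, transf⟩)
    (h𝒞 : IsConstraintClass 𝒞) (hE : InnerCond U Q R T H d A B G) (hD : D ∈ defs)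
    (hK : D.head = some K) (hf : CanFold 𝒞 U H d A B G D θ)
    (hE' : IsReplaced (⟨H, d, A ::ₘ B ::ₘ G⟩ : Clause L ar).vars H d G K θ E') :
    Inv 𝒞 U Cinit Q R
      ⟨some (C, (T \ {⟨H, d, A ::ₘ B ::ₘ G⟩}) ∪ {E'}), inCls, defs, transf⟩ where
  __ := h
  current := by
    intro c hc
    obtain rfl := Option.some.inj hc
    obtain ⟨hC, hT, hO, hS, hM⟩ := h.current _ rfl
    obtain ⟨N, A', B', hN⟩ := h.isDefn D hD
    obtain rfl : K = N := Option.some.inj (hK.symm.trans hN.head)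
    refine ⟨hC, hT.sdiff.union (Set.finite_singleton _), ?_, ?_, ?_⟩
    · rintro F (hF | rfl)
      · exact hO F hF.1
      · exact hE'.constr_mem h𝒞 (hO _ hE.1)
    · exact hS.replace hE.1 subset_rfl fun I hI => hE'.yields_of_defines hf hK (hI D hD)
    · exact hM.replace subset_rfl fun I J hI =>
        hE'.yields_of_folded hf hK hN.vars_body (hI D hD)

theorem Inv.define {inCls defs transf : Set (Clause L ar)} {C : Clause L ar}
    {H : Option (Atom ar)} {d : L.Formula ℕ} {A B N : Atom ar} {G : Multiset (Atom ar)}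
    {l : List (ℕ × ℕ)} (h : Inv 𝒞 U Cinit Q R ⟨some (C, T), inCls, defs, transf⟩)
    (hE : InnerCond U Q R T H d A B G)
    (hn : ¬ ∃ D ∈ defs, ∃ θ : ℕ → ℕ, CanFold 𝒞 U H d A B G D θ)
    (hnew : N.pred ∉ (⟨some (C, T), inCls, defs, transf⟩ : State L ar).preds ∪
      predsOf Q ∪ predsOf R)
    (hvars : N.vars = A.vars ∪ B.vars) (hl : l.toFinset = eqPairs U d A B) :
    Inv 𝒞 U Cinit Q R
      ⟨some (C, (T \ {⟨H, d, A ::ₘ B ::ₘ G⟩}) ∪ {⟨H, d, N ::ₘ G⟩}),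
        inCls ∪ {⟨some N, conjEqs l, {A, B}⟩}, defs ∪ {⟨some N, conjEqs l, {A, B}⟩}, transf⟩ := by
  classical
  have hfresh : N.pred ∉ predsOf Q ∪ predsOf R := fun hp => hnew (by
    rcases hp with hp | hp
    · exact Or.inl (Or.inr hp)
    · exact Or.inr hp)
  have hdefs : ∀ D ∈ defs, ∀ N' ∈ D.head, N'.pred ≠ N.pred := fun D hD N' hN' hp =>
    hnew (Or.inl (Or.inl (Or.inl (Or.inl (Or.inr (hp ▸ mem_predsOf_of_head hD hN'))))))
  set D₀ : Clause L ar := ⟨some N, conjEqs l, {A, B}⟩ with hD₀def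
  have hD₀ : IsDefn U Q R D₀ N A B := isDefn_newDef hfresh hE.2.1 hE.2.2.1 hvars hl
  obtain ⟨hC, hT, hO, hS, hM⟩ := h.current _ rfl
  constructor
  · exact h.finite_inCls.union (Set.finite_singleton _)
  · exact h.finite_defs.union (Set.finite_singleton _)
  · exact h.finite_transfCls
  · rintro F (hF | rfl)
    · exact (h.inCls_subset hF).imp_right Or.inl
    · exact Or.inr (Or.inr rfl)
  · rintro F (hF | rfl)
    · exact h.isDefn F hF
    · exact ⟨N, A, B, hD₀⟩
  · rintro D (hD | rfl) D' (hD' | rfl) M hM M' hM' hp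
    · exact h.head_unique D hD D' hD' M hM M' hM' hp
    · obtain rfl : N = M' := Option.some.inj hM'
      exact (hdefs D hD M hM hp).elim
    · obtain rfl : N = M := Option.some.inj hM
      exact (hdefs D' hD' M' hM' hp.symm).elim
    · rfl
  · obtain ⟨f, hf, hf'⟩ := h.shape_injOn
    have hD₀n : D₀ ∉ defs := fun hD => hdefs D₀ hD N rfl rfl
    have hne : ∀ D ∈ defs, D ≠ D₀ := fun D hD hDD => hD₀n (hDD ▸ hD)
    have hshape : ∀ D ∈ defs, f D ≠ shape U D₀.constr A B := by
      intro D hD hs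
      obtain ⟨N', A', B', hN', hfD⟩ := hf' D hD
      refine hn ⟨D, hD, canFold_of_shape_eq (hO _ hE.1) hN'.body hN'.bodyVars_subset hN'.constr ?_⟩
      rw [← hfD, hs]
      exact shape_congr (eqPairs_conjEqs hl)
    refine ⟨Function.update f D₀ (shape U D₀.constr A B), ?_, ?_⟩
    · rintro D (hD | rfl) D' (hD' | rfl) hDD
      · rw [Function.update_of_ne (hne D hD), Function.update_of_ne (hne D' hD')] at hDD
        exact hf hD hD' hDD
      · rw [Function.update_of_ne (hne D hD), Function.update_self] at hDD
        exact (hshape D hD hDD).elim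
      · rw [Function.update_of_ne (hne D' hD'), Function.update_self] at hDD
        exact (hshape D' hD' hDD.symm).elim
      · rfl
    · rintro D (hD | rfl)
      · rw [Function.update_of_ne (hne D hD)]
        exact hf' D hD
      · exact ⟨N, A, B, hD₀, Function.update_self _ _ _⟩
  · exact h.subset_transfCls
  · exact h.sound.mono Set.subset_union_left
  · intro F hF hF'
    have hF₁ : F ∉ inCls := fun hF₁ => hF' (Or.inl hF₁)
    have hF₂ : F ∈ insert Cinit defs := by
      rcases hF with rfl | hF | hF
      · exact Or.inl rfl
      · exact Or.inr hF
      · exact (hF' (Or.inr hF)).elim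
    exact (h.simulates F hF₂ hF₁).mono Set.subset_union_left subset_rfl
  · intro c hc
    obtain rfl := Option.some.inj hc
    refine ⟨Or.inl hC, hT.sdiff.union (Set.finite_singleton _), ?_, ?_, ?_⟩
    · rintro F (hF | rfl)
      · exact hO F hF.1
      · exact hO ⟨H, d, A ::ₘ B ::ₘ G⟩ hE.1
    · exact hS.replace hE.1 Set.subset_union_left fun I hI =>
        yields_newDef_of_defines (hI D₀ (Or.inr rfl))
    · refine hM.replace Set.subset_union_left fun I J hI =>
        yields_of_newDef (hI D₀ (Or.inr rfl)) fun val hd => realize_conjEqs.2 fun z hz => ?_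
      rw [← List.mem_toFinset, hl, mem_eqPairs] at hz
      exact hz.2 val hd

theorem Inv.finish {inCls defs transf : Set (Clause L ar)} {C : Clause L ar}
    (h : Inv 𝒞 U Cinit Q R ⟨some (C, T), inCls, defs, transf⟩) :
    Inv 𝒞 U Cinit Q R ⟨none, inCls \ {C}, defs, transf ∪ T⟩ := by
  obtain ⟨hC, hT, hO, hS, hM⟩ := h.current _ rfl
  exact
    { finite_inCls := h.finite_inCls.sdiff
      finite_defs := h.finite_defs
      finite_transfCls := h.finite_transfCls.union hT
      inCls_subset := Set.sdiff_subset.trans h.inCls_subset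
      isDefn := h.isDefn
      head_unique := h.head_unique
      shape_injOn := h.shape_injOn
      subset_transfCls := h.subset_transfCls.trans Set.subset_union_left
      sound := by
        rintro I hI hD F (hF | hF)
        · exact h.sound I hI hD F hF
        · exact hS I hI hD F hF
      simulates := by
        intro F hF hF'
        by_cases hFC : F = C
        · subst hFC
          exact hM.mono subset_rfl Set.subset_union_right
        · exact (h.simulates F hF fun hF₁ => hF' ⟨hF₁, hFC⟩).mono subset_rfl
            Set.subset_union_left
      current := by simp }

theorem Inv.step (h : Inv 𝒞 U Cinit Q R s) (h𝒞 : IsConstraintClass 𝒞)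
    (hCinit : Cinit.constr ∈ 𝒞) (hQfin : Q.Finite) (hRfin : R.Finite) (hQ : Over 𝒞 Q)
    (hR : Over 𝒞 R) (hst : Step 𝒞 U Q R s t) : Inv 𝒞 U Cinit Q R t := by
  cases hst with
  | unfold inCls defs transf C A B T hC hT =>
    exact h.unfold h𝒞 hCinit hQfin hRfin hQ hR hC hT
  | fold inCls defs transf C T H d A B G D K θ E' hE hD hK hf hE' =>
    exact h.fold h𝒞 hE hD hK hf hE'
  | define inCls defs transf C T H d A B G N l hE hn hnew hvars hl =>
    exact h.define hE hn hnew hvars hl.2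
  | finish inCls defs transf C T hn => exact h.finish

/-- The definitions have distinct shapes, so that their number is bounded by that of the shapes of
the pairs of atoms over the predicate symbols of `Q` and of `R`. -/
theorem Inv.encard_defs_le (h : Inv 𝒞 U Cinit Q R s) :
    s.defs.encard ≤ (shapes ar (predsOf Q) (predsOf R)).encard := by
  obtain ⟨f, hf, hf'⟩ := h.shape_injOn
  rw [← hf.encard_image]
  refine Set.encard_le_encard ?_
  rintro _ ⟨D, hD, rfl⟩
  obtain ⟨N, A, B, hN, hfD⟩ := hf' D hD
  rw [hfD]
  exact shape_mem_shapes hN.predA hN.predB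

end Invariant

/-! ### Termination -/

section Termination

variable {L : FirstOrder.Language.{u, v}} {Pred : Type x} {ar : Pred → ℕ}
  {𝒞 : Set (L.Formula ℕ)} {U : Type w} [L.Structure U] {Cinit : Clause L ar}
  {Q R T : Set (Clause L ar)} {s t : State L ar}

/-- The total number of the atoms in the bodies of the clauses of a finite set. -/
noncomputable def bodySize (T : Set (Clause L ar)) : ℕ := ∑ᶠ E ∈ T, E.body.card

theorem bodySize_replace_lt (hT : T.Finite) {E E' : Clause L ar} (hE : E ∈ T)
    (h : E'.body.card < E.body.card) : bodySize ((T \ {E}) ∪ {E'}) < bodySize T := by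
  have h1 : bodySize T = E.body.card + bodySize (T \ {E}) := by
    unfold bodySize
    rw [← finsum_mem_insert (fun E : Clause L ar => E.body.card)
      (fun hmem : E ∈ T \ {E} => hmem.2 rfl) hT.sdiff, Set.insert_sdiff_singleton,
      Set.insert_eq_of_mem hE]
  have h2 : bodySize ((T \ {E}) ∪ {E'}) ≤ E'.body.card + bodySize (T \ {E}) := by
    unfold bodySize
    rw [Set.union_singleton]
    by_cases hE' : E' ∈ T \ {E}
    · rw [Set.insert_eq_of_mem hE']
      exact Nat.le_add_left _ _
    · rw [finsum_mem_insert _ hE' hT.sdiff]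
  omega

/-- The termination measure, compared lexicographically; `k` bounds the number of definitions. A
new definition adds one clause to `InCls`, which the weight `2` of its first component
compensates for. -/
noncomputable def measure (k : ℕ) (s : State L ar) : ℕ ×ₗ (ℕ ×ₗ ℕ) :=
  toLex (2 * (k - s.defs.ncard) + s.inCls.ncard,
    toLex (s.current.elim 1 fun _ => 0, s.current.elim 0 fun c => bodySize c.2))

theorem measure_lt_of_step (k : ℕ) (hk : t.defs.ncard ≤ k) (hs : Inv 𝒞 U Cinit Q R s)
    (hst : Step 𝒞 U Q R s t) : measure k t < measure k s := by
  simp only [measure, Prod.Lex.toLex_lt_toLex]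
  cases hst with
  | unfold inCls defs transf C A B T hC hT => simp
  | fold inCls defs transf C T H d A B G D K θ E' hE hD hK hf hE' =>
    refine Or.inr ⟨rfl, Or.inr ⟨rfl, ?_⟩⟩
    refine bodySize_replace_lt (hs.current _ rfl).2.1 hE.1 ?_
    rw [hE'.card_body]
    simp
  | define inCls defs transf C T H d A B G N l hE hn hnew hvars hl =>
    left
    have h1 : (⟨some N, conjEqs l, {A, B}⟩ : Clause L ar) ∉ defs := fun hD =>
      hnew (Or.inl (Or.inl (Or.inl (Or.inl (Or.inr (mem_predsOf_of_head hD rfl))))))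
    have h2 : (defs ∪ {⟨some N, conjEqs l, {A, B}⟩}).ncard = defs.ncard + 1 := by
      rw [Set.union_singleton]
      exact Set.ncard_insert_of_notMem h1 hs.finite_defs
    have h3 : (inCls ∪ {⟨some N, conjEqs l, {A, B}⟩}).ncard ≤ inCls.ncard + 1 := by
      rw [Set.union_singleton]
      exact Set.ncard_insert_le _ _
    simp only at hk ⊢
    omega
  | finish inCls defs transf C T hn =>
    left
    have h1 : (inCls \ {C}).ncard < inCls.ncard :=
      Set.ncard_sdiff_singleton_lt_of_mem (hs.current _ rfl).1 hs.finite_inCls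
    simp only
    omega

theorem Inv.finite_preds (h : Inv 𝒞 U Cinit Q R s) : s.preds.Finite := by
  refine ((finite_predsOf h.finite_inCls).union (finite_predsOf h.finite_defs)).union
    (finite_predsOf h.finite_transfCls) |>.union ?_
  rcases hc : s.current with _ | c
  · refine Set.finite_empty.subset ?_
    rintro p ⟨c, hc', -⟩
    simp at hc'
  · refine (c.1.finite_preds.union (finite_predsOf (h.current c hc).2.1)).subset ?_
    rintro p ⟨c', hc', hp⟩
    obtain rfl : c = c' := by simpa using hc'
    exact hp

theorem exists_atom_vars_eq (hPred : ∀ n : ℕ, {p : Pred | ar p = n}.Infinite) {F : Set Pred}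
    (hF : F.Finite) (V : Finset ℕ) : ∃ N : Atom ar, N.pred ∉ F ∧ N.vars = V := by
  obtain ⟨p, hp, hpF⟩ := (hPred V.card).exists_notMem_finite hF
  have hp : ar p = V.card := hp
  let e : Fin (ar p) ≃ V := (finCongr hp).trans V.equivFin.symm
  refine ⟨⟨p, fun i => e i, Subtype.val_injective.comp e.injective⟩, hpF, ?_⟩
  ext X
  rw [Atom.mem_vars]
  constructor
  · rintro ⟨i, rfl⟩
    exact (e i).2
  · intro hX
    exact ⟨e.symm ⟨X, hX⟩, by simp⟩

/-- The strategy can proceed from every state that is not final. -/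
theorem Inv.exists_step (h : Inv 𝒞 U Cinit Q R s)
    (hPred : ∀ n : ℕ, {p : Pred | ar p = n}.Infinite) (hQfin : Q.Finite) (hRfin : R.Finite)
    (hs : ¬ s.IsFinal Q R) : ∃ t, Step 𝒞 U Q R s t := by
  obtain ⟨_ | ⟨C, T⟩, inCls, defs, transf⟩ := s
  · by_cases hC : ∃ C A B, OuterCond Q R inCls C A B
    · obtain ⟨C, A, B, hC⟩ := hC
      obtain ⟨T, hT⟩ := exists_isDoubleUnfolding (Q ∪ R) hC.2.1
      exact ⟨_, .unfold inCls defs transf C A B T hC hT⟩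
    · exact (hs ⟨rfl, hC⟩).elim
  · by_cases hE : ∃ H d A B G, InnerCond U Q R T H d A B G
    · obtain ⟨H, d, A, B, G, hE⟩ := hE
      by_cases hf : ∃ D ∈ defs, ∃ θ : ℕ → ℕ, CanFold 𝒞 U H d A B G D θ
      · obtain ⟨D, hD, θ, hf⟩ := hf
        obtain ⟨N, A', B', hN⟩ := h.isDefn D hD
        obtain ⟨E', hE'⟩ := exists_isReplaced
          (⟨H, d, A ::ₘ B ::ₘ G⟩ : Clause L ar).finite_vars H d G N θ
        exact ⟨_, .fold inCls defs transf C T H d A B G D N θ E' hE hD hN.head hf hE'⟩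
      · obtain ⟨N, hN, hNv⟩ := exists_atom_vars_eq hPred
          ((h.finite_preds.union (finite_predsOf hQfin)).union (finite_predsOf hRfin))
          (A.vars ∪ B.vars)
        exact ⟨_, .define inCls defs transf C T H d A B G N (eqPairs U d A B).toList hE hf hN hNv
          ⟨Finset.nodup_toList _, Finset.toList_toFinset _⟩⟩
    · exact ⟨_, .finish inCls defs transf C T hE⟩

end Termination

/-! ### From the transformed clauses back to the original ones -/

section Completeness

variable {L : FirstOrder.Language.{u, v}} {Pred : Type x} {ar : Pred → ℕ}
  {𝒞 : Set (L.Formula ℕ)} {U : Type w} [L.Structure U] {Cinit : Clause L ar}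
  {P Q R T : Set (Clause L ar)} {s : State L ar} {J : Interp ar U}

/-- The stages of the least fixpoint of the immediate consequence operator of `P`, on the predicate
symbols of `P`; the other ones are interpreted by `J` throughout. -/
def stage (P : Set (Clause L ar)) (J : Interp ar U) : ℕ → Interp ar U
  | 0 => fun p t => p ∉ predsOf P ∧ J p t
  | n + 1 => fun p t => (p ∈ predsOf P ∧ conseq P (stage P J n) p t) ∨ (p ∉ predsOf P ∧ J p t)

theorem conseq_mono {I I' : Interp ar U} (h : ∀ p t, I p t → I' p t) {p : Pred}
    {t : Fin (ar p) → U} (hI : conseq P I p t) : conseq P I' p t := by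
  obtain ⟨K, hK, a, ha, val, hc, hb, ht⟩ := hI
  exact ⟨K, hK, a, ha, val, hc, fun b hb' => h _ _ (hb b hb'), ht⟩

theorem conseq_le_of_isModel (hJ : J.IsModel P) {p : Pred} {t : Fin (ar p) → U}
    (h : conseq P J p t) : J p t := by
  obtain ⟨K, hK, a, ha, val, hc, hb, ht⟩ := h
  have h1 := hJ K hK val hc hb
  rw [show K.head = some a from ha] at h1
  exact (iff_of_eq (congrArg (fun t : Σ p : Pred, (Fin (ar p) → U) => J t.1 t.2) ht)).1 h1

theorem stage_le (hJ : J.IsModel P) (n : ℕ) : ∀ p t, stage P J n p t → J p t := by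
  induction n with
  | zero => exact fun p t h => h.2
  | succ n ih =>
    rintro p t (h | h)
    · exact conseq_le_of_isModel hJ (conseq_mono ih h.2)
    · exact h.2

theorem stage_le_succ (n : ℕ) : ∀ p t, stage P J n p t → stage P J (n + 1) p t := by
  induction n with
  | zero => exact fun p t h => Or.inr h
  | succ n ih =>
    rintro p t (h | h)
    · exact Or.inl ⟨h.1, conseq_mono ih h.2⟩
    · exact Or.inr h

theorem stage_mono {m n : ℕ} (h : m ≤ n) {p : Pred} {t : Fin (ar p) → U}
    (hm : stage P J m p t) : stage P J n p t := by
  induction h with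
  | refl => exact hm
  | step _ ih => exact stage_le_succ _ _ _ ih

theorem exists_stage_of_forall {b : Multiset (Atom ar)} {val : ℕ → U}
    (h : ∀ a ∈ b, ∃ n, (stage P J n).Holds val a) : ∃ n, ∀ a ∈ b, (stage P J n).Holds val a := by
  induction b using Multiset.induction_on with
  | empty => exact ⟨0, by simp⟩
  | cons a b ih =>
    obtain ⟨n, hn⟩ := h a (Multiset.mem_cons_self _ _)
    obtain ⟨m, hm⟩ := ih fun c hc => h c (Multiset.mem_cons_of_mem hc)
    refine ⟨max n m, fun c hc => ?_⟩
    rcases Multiset.mem_cons.1 hc with rfl | hc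
    · exact stage_mono (le_max_left _ _) hn
    · exact stage_mono (le_max_right _ _) (hm c hc)

/-- The limit of the stages is a model of `P`. -/
theorem isModel_limit (hJ : J.IsModel P) :
    Interp.IsModel (fun p t => ∃ n, stage P J n p t : Interp ar U) P := by
  intro K hK val hc hb
  obtain ⟨n, hn⟩ := exists_stage_of_forall hb
  rcases hh : K.head with _ | a
  · have h1 := hJ K hK val hc fun b hb' => stage_le hJ n _ _ (hn b hb')
    rw [hh] at h1
    exact h1
  · exact ⟨n + 1, Or.inl ⟨mem_predsOf_of_head hK hh, K, hK, a, hh, val, hc, hn, rfl⟩⟩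

theorem predsOf_union (P P' : Set (Clause L ar)) : predsOf (P ∪ P') = predsOf P ∪ predsOf P' := by
  ext p
  simp [predsOf, or_and_right, exists_or]

/-- If all the definitions have been processed, then they are true in every stage. By induction on
the stage: the body of a clause unfolds to atoms of the previous stage, where the definitions used
for folding are true already. -/
theorem Inv.yields_stage (h : Inv 𝒞 U Cinit Q R s) (hin : s.inCls = ∅) {q r : Atom ar}
    (hq : q.pred ∈ predsOf Q) (hr : r.pred ∈ predsOf R) (hbody : Cinit.body = {q, r})
    (hJ : J.IsModel s.transfCls) (n : ℕ) :
    (∀ D ∈ s.defs, D.Yields (stage (Q ∪ R) J n) (stage (Q ∪ R) J n)) ∧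
      Cinit.Yields (stage (Q ∪ R) J n) J := by
  have hJ' : J.IsModel (Q ∪ R) := fun K hK => hJ K (h.subset_transfCls hK)
  have hdef : ∀ D ∈ s.defs, ∀ I : Interp ar U, D.Yields I J → (∀ p t, p ∉ predsOf (Q ∪ R) →
      J p t → I p t) → D.Yields I I := by
    intro D hD I hDI hI val hc hb
    obtain ⟨N, A, B, hN⟩ := h.isDefn D hD
    have h1 := hDI val hc hb
    rw [hN.head] at h1 ⊢
    exact hI _ _ (by rw [predsOf_union]; exact hN.fresh) h1
  have hpred : ∀ C ∈ insert Cinit s.defs, ∀ b ∈ C.body, b.pred ∈ predsOf (Q ∪ R) := by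
    intro C hC b hb
    rw [predsOf_union]
    rcases hC with rfl | hC
    · rw [hbody] at hb
      simp only [Multiset.insert_eq_cons, Multiset.mem_cons, Multiset.mem_singleton] at hb
      rcases hb with rfl | rfl
      · exact Or.inl hq
      · exact Or.inr hr
    · obtain ⟨N, A, B, hN⟩ := h.isDefn C hC
      exact hN.pred_of_body hb
  have hne : ∀ C ∈ insert Cinit s.defs, ∃ b, b ∈ C.body := by
    rintro C (rfl | hC)
    · exact ⟨q, by simp [hbody]⟩
    · obtain ⟨N, A, B, hN⟩ := h.isDefn C hC
      exact ⟨A, by simp [hN.body]⟩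
  have key : ∀ n, (∀ C ∈ insert Cinit s.defs, C.Yields (stage (Q ∪ R) J n) J) →
      ∀ D ∈ s.defs, D.Yields (stage (Q ∪ R) J n) (stage (Q ∪ R) J n) := by
    intro n hn D hD
    refine hdef D hD _ (hn D (Or.inr hD)) fun p t hp hJp => ?_
    cases n with
    | zero => exact ⟨hp, hJp⟩
    | succ n => exact Or.inr ⟨hp, hJp⟩
  have main : ∀ C ∈ insert Cinit s.defs, C.Yields (stage (Q ∪ R) J n) J := by
    induction n with
    | zero =>
      intro C hC val hc hb
      obtain ⟨b, hbC⟩ := hne C hC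
      exact ((hb b hbC).1 (hpred C hC b hbC)).elim
    | succ n ih =>
      intro C hC val hc hb
      have h1 := h.simulates C hC (by simp [hin]) (stage (Q ∪ R) J n) J (key n ih)
        fun E hE val hc hb => hJ E hE val hc fun b hb' => stage_le hJ' n _ _ (hb b hb')
      refine h1 val hc fun b hbC => ?_
      rcases hb b hbC with hb | hb
      · exact hb.2
      · exact (hb.1 (hpred C hC b hbC)).elim
  exact ⟨key n main, main Cinit (Or.inl rfl)⟩

theorem Inv.dSat_of_transfCls (h : Inv 𝒞 U Cinit Q R s) (hin : s.inCls = ∅) {q r : Atom ar}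
    (hq : q.pred ∈ predsOf Q) (hr : r.pred ∈ predsOf R) (hbody : Cinit.body = {q, r})
    (hhead : Cinit.head = none) (hsat : DSat U s.transfCls) : DSat U ({Cinit} ∪ Q ∪ R) := by
  obtain ⟨J, hJ⟩ := hsat
  have hJ' : J.IsModel (Q ∪ R) := fun K hK => hJ K (h.subset_transfCls hK)
  refine ⟨fun p t => ∃ n, stage (Q ∪ R) J n p t, ?_⟩
  rw [Set.union_assoc]
  rintro C (rfl | hC)
  · intro val hc hb
    obtain ⟨n, hn⟩ := exists_stage_of_forall hb
    have h1 := (h.yields_stage hin hq hr hbody hJ n).2 val hc hn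
    rw [hhead] at h1
    exact h1.elim
  · exact isModel_limit hJ' C hC

end Completeness

/-! ### From the original clauses to the transformed ones -/

section Soundness

variable {L : FirstOrder.Language.{u, v}} {Pred : Type x} {ar : Pred → ℕ}
  {𝒞 𝒜 : Set (L.Formula ℕ)} {U : Type w} [L.Structure U] {Cinit : Clause L ar}
  {P Q R T : Set (Clause L ar)} {s : State L ar}

theorem Inv.isModel_transfCls (h : Inv 𝒞 U Cinit Q R s)
    (hCinit : Cinit.preds ⊆ predsOf Q ∪ predsOf R) {I I' : Interp ar U}
    (hI : I.IsModel ({Cinit} ∪ Q ∪ R)) (hII' : ∀ p ∈ predsOf Q ∪ predsOf R, I p = I' p)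
    (hI' : ∀ D ∈ s.defs, Defines I' D) : I'.IsModel s.transfCls := by
  refine h.sound I' (fun C hC => Clause.Yields.congr (hI C hC) fun p hp => hII' p ?_) hI'
  rcases hC with (rfl | hC) | hC
  · exact hCinit hp
  · exact Or.inl ⟨C, hC, hp⟩
  · exact Or.inr ⟨C, hC, hp⟩

/-- The extension of `I` to new predicate symbols by the definitions in `defs`; the interpretation
of the symbols in `S` is not changed. -/
def extend (S : Set Pred) (defs : Set (Clause L ar)) (I : Interp ar U) : Interp ar U := fun p t =>
  (p ∈ S ∧ I p t) ∨ (p ∉ S ∧ ∃ D ∈ defs, ∃ N ∈ D.head, ∃ val : ℕ → U, N.tuple val = ⟨p, t⟩ ∧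
    D.constr.Realize val ∧ ∀ b ∈ D.body, I.Holds val b)

theorem Inv.defines_extend (h : Inv 𝒞 U Cinit Q R s) (I : Interp ar U) :
    ∀ D ∈ s.defs, Defines (extend (predsOf Q ∪ predsOf R) s.defs I) D := by
  intro D hD N hN val
  obtain ⟨N', A, B, hNAB⟩ := h.isDefn D hD
  obtain rfl : N = N' := Option.some.inj (hN.symm.trans hNAB.head)
  constructor
  · rintro (h1 | ⟨-, D', hD', N', hN', val', ht, hc, hb⟩)
    · exact (hNAB.fresh h1.1).elim
    · obtain rfl := h.head_unique D' hD' D hD N' hN' N hN (congrArg Sigma.fst ht)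
      obtain rfl : N' = N := Option.some.inj (hN'.symm.trans hN)
      have hv : ∀ X ∈ N'.vars, val' X = val X := fun X hX => Atom.eqOn_of_tuple_eq ht hX
      refine ⟨(realize_congr _ fun X hX => hv X (hNAB.fvars_constr hX)).1 hc, fun b hb' => ?_⟩
      exact Or.inl ⟨hNAB.pred_of_body hb', (Interp.holds_congr fun X hX =>
        hv X (hNAB.mem_vars_of_body hb' hX)).1 (hb b hb')⟩
  · rintro ⟨hc, hb⟩
    refine Or.inr ⟨hNAB.fresh, D, hD, N, hN, val, rfl, hc, fun b hb' => ?_⟩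
    rcases hb b hb' with h1 | h1
    · exact h1.2
    · exact (h1.1 (hNAB.pred_of_body hb')).elim

theorem Inv.dSat_transfCls (h : Inv 𝒞 U Cinit Q R s)
    (hCinit : Cinit.preds ⊆ predsOf Q ∪ predsOf R) (hsat : DSat U ({Cinit} ∪ Q ∪ R)) :
    DSat U s.transfCls := by
  obtain ⟨I, hI⟩ := hsat
  refine ⟨_, h.isModel_transfCls hCinit hI (fun p hp => ?_) (h.defines_extend I)⟩
  funext t
  simp [extend, hp]

/-- The interpretation denoted by a symbolic interpretation. -/
def SymbInterp.toInterp (S : SymbInterp ar 𝒜) (U : Type w) [L.Structure U] : Interp ar U :=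
  fun p t => ∃ (a : Atom ar) (val : ℕ → U), a.tuple val = ⟨p, t⟩ ∧ (S.toFun a).Realize val

theorem SymbInterp.holds_toInterp (S : SymbInterp ar 𝒜) (a : Atom ar) (val : ℕ → U) :
    (S.toInterp U).Holds val a ↔ (S.toFun a).Realize val := by
  refine ⟨?_, fun h => ⟨a, val, rfl, h⟩⟩
  rintro ⟨b, val', ht, hr⟩
  obtain ⟨σ, rfl, -⟩ := Atom.exists_rename_eq (a := b) (A := a) (congrArg Sigma.fst ht) ∅ ∅
  rw [S.rename, Formula.realize_relabel]
  refine (realize_congr _ fun X hX => ?_).1 hr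
  exact Atom.eqOn_of_tuple_eq (a := b) (f := val') (g := val ∘ σ) ht (S.fvars_subset b hX)

theorem SymbInterp.isModel_iff (S : SymbInterp ar 𝒜) (P : Set (Clause L ar)) :
    S.IsModel U P ↔ (S.toInterp U).IsModel P := by
  unfold SymbInterp.IsModel Interp.IsModel
  refine forall₄_congr fun C _ val _ => ?_
  have h1 : (S.onHead C.head).Realize val ↔ (S.toInterp U).HoldsHead val C.head := by
    rcases C.head with _ | a
    · exact Formula.realize_bot
    · exact (S.holds_toInterp a val).symm
  simp only [h1, S.holds_toInterp]

/-- A formula `χ` for the atom `N` determines formulas for all the atoms with the same predicate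
symbol, by renaming. -/
theorem exists_equivariant (h𝒜 : IsConstraintClass 𝒜) {N : Atom ar} {χ : L.Formula ℕ}
    (hχ : IsExDisj 𝒜 χ) (hv : fvars χ ⊆ N.vars) : ∃ t : Atom ar → L.Formula ℕ,
      (∀ a, a.pred = N.pred → IsExDisj 𝒜 (t a) ∧ fvars (t a) ⊆ a.vars ∧
        ∀ σ : Equiv.Perm ℕ, t (a.rename σ) = (t a).relabel σ) ∧
      ∀ val : ℕ → U, (t N).Realize val ↔ χ.Realize val := by
  have h : ∀ a : Atom ar, ∃ σ : Equiv.Perm ℕ, a.pred = N.pred → N.rename σ = a := by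
    intro a
    by_cases ha : a.pred = N.pred
    · obtain ⟨σ, hσ, -⟩ := Atom.exists_rename_eq ha.symm ∅ ∅
      exact ⟨σ, fun _ => hσ⟩
    · exact ⟨1, fun h => (ha h).elim⟩
  choose σ hσ using h
  -- renamings with the same effect on `N` agree on the free variables of `χ`
  have hag : ∀ τ τ' : Equiv.Perm ℕ, N.rename τ = N.rename τ' → ∀ X ∈ fvars χ, τ X = τ' X :=
    fun τ τ' h X hX => Atom.eqOn_of_tuple_eq (a := N) (f := τ) (g := τ')
      (congrArg (Atom.tuple id) h) (hv hX)
  refine ⟨fun a => χ.relabel (σ a), fun a ha => ⟨hχ.relabel h𝒜 _, ?_, fun τ => ?_⟩, fun val => ?_⟩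
  · refine (fvars_relabel_subset _ _).trans ?_
    conv_rhs => rw [← hσ a ha, Atom.vars_rename]
    exact Finset.image_subset_image hv
  · dsimp only
    rw [Formula.relabel_relabel]
    refine relabel_congr χ fun X hX => ?_
    refine hag (σ (a.rename τ)) ((σ a).trans τ) ?_ X hX
    rw [hσ (a.rename τ) ha]
    conv_lhs => rw [← hσ a ha]
    rfl
  · dsimp only
    rw [Formula.realize_relabel]
    refine realize_congr χ fun X hX => congrArg val (hag (σ N) 1 ?_ X hX)
    rw [hσ N rfl]
    rfl

/-- An `𝒜`-definable interpretation extends to the new predicate symbols: the formula for the head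
of a definition is equivalent to its body. -/
theorem Inv.exists_symbInterp (h : Inv 𝒞 U Cinit Q R s) (h𝒜 : IsConstraintClass 𝒜)
    (S : SymbInterp ar 𝒜) : ∃ S' : SymbInterp ar 𝒜,
      (∀ a, a.pred ∈ predsOf Q ∪ predsOf R → S'.toFun a = S.toFun a) ∧
      ∀ D ∈ s.defs, Defines (S'.toInterp U) D := by
  have ht : ∀ p : Pred, ∃ t : Atom ar → L.Formula ℕ,
      (∀ a, a.pred = p → IsExDisj 𝒜 (t a) ∧ fvars (t a) ⊆ a.vars ∧
        ∀ σ : Equiv.Perm ℕ, t (a.rename σ) = (t a).relabel σ) ∧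
      (p ∈ predsOf Q ∪ predsOf R → t = S.toFun) ∧
      ∀ D ∈ s.defs, ∀ N ∈ D.head, N.pred = p → ∀ val : ℕ → U, (t N).Realize val ↔
        D.constr.Realize val ∧ ∀ b ∈ D.body, (S.toFun b).Realize val := by
    intro p
    by_cases hp : ∃ D ∈ s.defs, ∃ N ∈ D.head, N.pred = p
    · obtain ⟨D, hD, N, hN, rfl⟩ := hp
      obtain ⟨N', A, B, hNAB⟩ := h.isDefn D hD
      obtain rfl : N = N' := Option.some.inj (hN.symm.trans hNAB.head)
      have hc : IsExDisj 𝒜 D.constr := .disj _ (.single _ (hNAB.constr_mem h𝒜))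
      obtain ⟨χ₁, hχ₁, hχ₁v, hχ₁r⟩ := hc.exists_inf h𝒜 (S.mem A) U
      obtain ⟨χ, hχ, hχv, hχr⟩ := hχ₁.exists_inf h𝒜 (S.mem B) U
      have hA : A ∈ D.body := by simp [hNAB.body]
      have hB : B ∈ D.body := by simp [hNAB.body]
      have hv : fvars χ ⊆ N.vars := by
        intro X hX
        rcases Finset.mem_union.1 (hχv hX) with hX | hX
        · rcases Finset.mem_union.1 (hχ₁v hX) with hX | hX
          · exact hNAB.fvars_constr hX
          · exact hNAB.mem_vars_of_body hA (S.fvars_subset A hX)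
        · exact hNAB.mem_vars_of_body hB (S.fvars_subset B hX)
      obtain ⟨t, ht, htN⟩ := exists_equivariant (U := U) h𝒜 hχ hv
      refine ⟨t, ht, fun hp => (hNAB.fresh hp).elim, fun D' hD' N' hN' hp val => ?_⟩
      obtain rfl := h.head_unique D' hD' D hD N' hN' N hN hp
      obtain rfl : N' = N := Option.some.inj (hN'.symm.trans hN)
      rw [htN, hχr, hχ₁r, hNAB.body]
      simp [and_assoc]
    · refine ⟨S.toFun, fun a _ => ⟨S.mem a, S.fvars_subset a, fun σ => S.rename σ a⟩,
        fun _ => rfl, fun D hD N hN hNp => (hp ⟨D, hD, N, hN, hNp⟩).elim⟩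
  choose t ht htS htD using ht
  let S' : SymbInterp ar 𝒜 :=
    { toFun := fun a => t a.pred a
      mem := fun a => (ht a.pred a rfl).1
      fvars_subset := fun a => (ht a.pred a rfl).2.1
      rename := fun σ a => (ht a.pred a rfl).2.2 σ }
  have hS' : ∀ a, a.pred ∈ predsOf Q ∪ predsOf R → S'.toFun a = S.toFun a := fun a ha =>
    congrFun (htS a.pred ha) a
  refine ⟨S', hS', fun D hD N hN val => ?_⟩
  obtain ⟨N', A, B, hNAB⟩ := h.isDefn D hD
  rw [S'.holds_toInterp]
  refine (htD N.pred D hD N hN rfl val).trans (and_congr_right fun _ => ?_)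
  refine forall₂_congr fun b hb => ?_
  rw [S'.holds_toInterp, hS' b (hNAB.pred_of_body hb)]

theorem Inv.hasDefModel_transfCls (h : Inv 𝒞 U Cinit Q R s) (h𝒜 : IsConstraintClass 𝒜)
    (hCinit : Cinit.preds ⊆ predsOf Q ∪ predsOf R) (hM : HasDefModel 𝒜 U ({Cinit} ∪ Q ∪ R)) :
    HasDefModel 𝒜 U s.transfCls := by
  obtain ⟨S, hS⟩ := hM
  obtain ⟨S', hS', hD⟩ := h.exists_symbInterp h𝒜 S
  refine ⟨S', (S'.isModel_iff _).2 (h.isModel_transfCls hCinit ((S.isModel_iff _).1 hS) ?_ hD)⟩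
  intro p hp
  funext t
  refine propext (exists_congr fun a => exists_congr fun val => and_congr_right fun ht => ?_)
  rw [hS' a (by rw [show a.pred = p from congrArg Sigma.fst ht]; exact hp)]

end Soundness

theorem Inv.inCls_eq_empty {L : FirstOrder.Language.{u, v}} {Pred : Type x} {ar : Pred → ℕ}
    {𝒞 : Set (L.Formula ℕ)} {U : Type w} [L.Structure U] {Cinit : Clause L ar}
    {Q R : Set (Clause L ar)} {s : State L ar} {q r : Atom ar} (h : Inv 𝒞 U Cinit Q R s)
    (hq : q.pred ∈ predsOf Q) (hr : r.pred ∈ predsOf R) (hbody : Cinit.body = {q, r})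
    (hfin : s.IsFinal Q R) : s.inCls = ∅ := by
  refine Set.eq_empty_of_forall_notMem fun C hC => hfin.2 ?_
  rcases h.inCls_subset hC with rfl | hD
  · exact ⟨C, q, r, hC, hbody, hq, hr⟩
  · obtain ⟨N, A, B, hN⟩ := h.isDefn C hD
    exact ⟨C, A, B, hC, hN.body, hN.predA, hN.predB⟩

end CHC

theorem theorem5 {L : FirstOrder.Language.{u, v}} (U : Type w) [Nonempty U] [L.Structure U]
    {Pred : Type x} (ar : Pred → ℕ) (hPred : ∀ n : ℕ, {p : Pred | ar p = n}.Infinite)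
    (𝒞 𝒜 : Set (L.Formula ℕ)) (h𝒞 : IsConstraintClass 𝒞) (h𝒜 : IsConstraintClass 𝒜)
    (h𝒜𝒞 : 𝒜 ⊆ 𝒞)
    (c : L.Formula ℕ) (hc : c ∈ 𝒞) (q r : Atom ar)
    (Q R : Set (Clause L ar)) (hQfin : Q.Finite) (hRfin : R.Finite)
    (hQ : Over 𝒞 Q) (hR : Over 𝒞 R) (hdisj : Disjoint Q R)
    (hpreds : Disjoint (predsOf Q) (predsOf R))
    (hq : q.pred ∈ predsOf Q) (hr : r.pred ∈ predsOf R)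
    (Cinit : Clause L ar) (hCinit : Cinit = ⟨none, c, {q, r}⟩) :
    -- finitely many definitions are introduced, with a bound that depends only on the input
    (∃ k : ℕ, ∀ s, Reachable 𝒞 U Cinit Q R s → s.defs.encard ≤ k) ∧
    -- no execution is infinite
    (¬ ∃ run : ℕ → State L ar, run 0 = initState Cinit Q R ∧
      ∀ n, Step 𝒞 U Q R (run n) (run (n + 1))) ∧
    -- an execution can get stuck only at the end of the outer loop
    (∀ s, Reachable 𝒞 U Cinit Q R s → ¬ s.IsFinal Q R → ∃ t, Step 𝒞 U Q R s t) ∧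
    -- correctness of the output
    (∀ s, Reachable 𝒞 U Cinit Q R s → s.IsFinal Q R →
      (DSat U ({Cinit} ∪ Q ∪ R) ↔ DSat U s.transfCls) ∧
      (HasDefModel 𝒜 U ({Cinit} ∪ Q ∪ R) → HasDefModel 𝒜 U s.transfCls)) := by
  have hbody : Cinit.body = {q, r} := by rw [hCinit]
  have hhead : Cinit.head = none := by rw [hCinit]
  have hconstr : Cinit.constr ∈ 𝒞 := by rw [hCinit]; exact hc
  have hCpreds : Cinit.preds ⊆ predsOf Q ∪ predsOf R := by
    rintro p (⟨a, ha, -⟩ | ⟨a, ha, rfl⟩)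
    · rw [hhead] at ha
      cases ha
    · rw [hbody] at ha
      simp only [Multiset.insert_eq_cons, Multiset.mem_cons, Multiset.mem_singleton] at ha
      rcases ha with rfl | rfl
      · exact Or.inl hq
      · exact Or.inr hr
  have hinv : ∀ s, Reachable 𝒞 U Cinit Q R s → Inv 𝒞 U Cinit Q R s := by
    intro s hs
    induction hs with
    | refl => exact inv_initState q.pred hQfin hRfin
    | tail _ hst ih => exact ih.step h𝒞 hconstr hQfin hRfin hQ hR hst
  have hfin : (shapes ar (predsOf Q) (predsOf R)).Finite :=
    finite_shapes (finite_predsOf hQfin) (finite_predsOf hRfin)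
  have hbound : ∀ s, Reachable 𝒞 U Cinit Q R s →
      s.defs.encard ≤ (shapes ar (predsOf Q) (predsOf R)).ncard := by
    intro s hs
    rw [hfin.cast_ncard_eq]
    exact (hinv s hs).encard_defs_le
  refine ⟨⟨_, hbound⟩, ?_, fun s hs hs' => (hinv s hs).exists_step hPred hQfin hRfin hs',
    fun s hs hs' => ⟨⟨(hinv s hs).dSat_transfCls hCpreds, fun h => ?_⟩,
      (hinv s hs).hasDefModel_transfCls h𝒜 hCpreds⟩⟩
  · rintro ⟨run, h0, hrun⟩
    have hreach : ∀ n, Reachable 𝒞 U Cinit Q R (run n) := by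
      intro n
      induction n with
      | zero => rw [h0]; exact .refl
      | succ n ih => exact ih.tail (hrun n)
    obtain ⟨n, hn⟩ := WellFounded.not_rel_apply_succ (r := (· < ·))
      fun n => measure (shapes ar (predsOf Q) (predsOf R)).ncard (run n)
    refine hn (measure_lt_of_step _ ?_ (hinv _ (hreach n)) (hrun n))
    have h1 := hbound _ (hreach (n + 1))
    rw [← (hinv _ (hreach (n + 1))).finite_defs.cast_ncard_eq] at h1
    exact_mod_cast h1
  · exact (hinv s hs).dSat_of_transfCls ((hinv s hs).inCls_eq_empty hq hr hbody hs') hq hr hbody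
      hhead h
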